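/- Let $\mu,\nu$ be probability measures on a measurable space $\mathbf X$ with $\nu\ll\mu$, and let $w:\mathbf X\to[0,\infty)$ be a measurable version of the Radon–Nikodým derivative $d\nu/d\mu$. For a probability measure $\pi$, a $\pi$-reversible Markov kernel $P$ and $f\in L^2(\pi)$, let $$\mathrm{var}(P,f)=\lim_{n\to\infty}\frac1n\,\mathbb E\Big[\Big(\sum_{k=1}^n\{f(X_k)-\pi(f)\}\Big)^2\Big]\in[0,\infty],$$ where $(X_k)_{k\ge0}$ is the Markov chain with transition kernel $P$ and $X_0\sim\pi$, and let $\mathrm{var}_\pi(f)=\int (f-\pi(f))^2\,d\pi\in[0,\infty]$ for $f\in L^1(\pi)$. For $\varphi\in L^2(\nu)$ write $\bar\varphi=\varphi-\nu(\varphi)$. For a Markov kernel $q$ on $\mathbf X$ and a probability measure $\pi$ let $r^{(\pi)}(x,x')$ be a version of the ratio $\frac{\pi(dx')q_{x'}(dx)}{\pi(dx)q_x(dx')}$: with $F(dx,dx')=\pi(dx)q_x(dx')$ and $F^{T}$ its image under $(x,x')\mapsto(x',x)$, there is a symmetric measurable set $R\subset\mathbf X^2$ such that $0<r^{(\pi)}<\infty$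 on $R$, $r^{(\pi)}$ is the density of $F^{T}$ with respect to $F$ on $R$, and off $R$ the measures $F,F^{T}$ are mutually singular and $r^{(\pi)}=0$. The kernel $\mathrm{MH}(q\to\pi)$ is $$q_x(dx')\min\{1,r^{(\pi)}(x,x')\}+[1-\alpha(x)]\,\delta_x(dx'),\qquad \alpha(x)=\int q_x(dx')\min\{1,r^{(\pi)}(x,x')\}.$$ The delayed acceptance (DA) correction of a $\mu$-reversible Markov kernel $K$ is $$K^{\mathrm{DA}}_x(dx')=K_x(dx')\min\Big\{1,\frac{w(x')}{w(x)}\Big\}+[1-\alpha_{\mathrm{DA}}(x)]\,\delta_x(dx'),\qquad \alpha_{\mathrm{DA}}(x)=\int K_x(dx')\min\Big\{1,\frac{w(x')}{w(x)}\Big\}$$ (for $w(x)=0$, which holds only on a $\nu$-null set of $x$, read $a/0=\infty$ if $a>0$ and $0/0=0$). Suppose that either (I) $K$ is a $\mu$-reversible Markov kernel and $L=K^{\mathrm{DA}}$, or (II) $K=\mathrm{MH}(q\to\mu)$ and $L=\mathrm{MH}(q\to\nu)$ for some Markov kernel $q$ on $\mathbf X$ (and any versions of the two ratios). Let $\underline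 c,\overline c\in[0,\infty)$. Then the following hold, with $0\cdot\infty=0$. (i) If $w\le\overline c$ $\mu$-a.e., then for all $\varphi\in L^2(\nu)$ we have $w\bar\varphi\in L^2(\mu)$, the limits defining $\mathrm{var}(K,w\bar\varphi)$ and $\mathrm{var}(L,\varphi)$ exist in $[0,\infty]$, and $$\mathrm{var}(K,w\bar\varphi)+\mathrm{var}_\mu(w\bar\varphi)\le\overline c\,\big[\mathrm{var}(L,\varphi)+\mathrm{var}_\nu(\varphi)\big].$$ (ii) If $w\ge\underline c$ $\mu$-a.e., then for all $\varphi\in L^2(\nu)$ with $w\varphi\in L^2(\mu)$ or $w\bar\varphi\in L^2(\mu)$, the limit defining $\mathrm{var}(L,\varphi)$ exists in $[0,\infty]$, as does that defining $\mathrm{var}(K,w\bar\varphi)$ if $w\bar\varphi\in L^2(\mu)$, and $$\mathrm{var}(K,w\bar\varphi)+\mathrm{var}_\mu(w\bar\varphi)\ge\underline c\,\big[\mathrm{var}(L,\varphi)+\mathrm{var}_\nu(\varphi)\big],$$ where the left side is read as $+\infty$ if $w\bar\varphi\notin L^2(\mu)$, since then $\mathrm{var}_\mu(w\bar\varphi)=\infty$.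 No ergodicity is required; in particular the statement covers the case where $K$ and $L$ define Harris ergodic chains. -/

import Mathlib

open MeasureTheory ProbabilityTheory Filter Topology
open scoped ENNReal NNReal

namespace PeskunIS

variable {X : Type*} [MeasurableSpace X]

/-- `(μ, ν, w)` is an importance sampling triplet: `ν ≪ μ` and the nonnegative measurable
function `w` is a version of the Radon-Nikodym derivative `dν/dμ`. -/
structure IsImportanceTriplet (μ ν : Measure X) (w : X → ℝ≥0) : Prop where
  absolutelyContinuous : ν ≪ μ
  measurable_weight : Measurable w
  weight_ae_eq : (fun x => (w x : ℝ≥0∞)) =ᵐ[μ] ν.rnDeriv μ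

/-- The law on path space `X^ℕ` of the Markov chain `(X_k)_{k ≥ 0}` with initial distribution
`X_0 ∼ μ` and time-homogeneous transition kernel `K`. -/
noncomputable def chainLaw (K : Kernel X X) [IsMarkovKernel K] (μ : Measure X) :
    Measure (ℕ → X) :=
  Kernel.trajMeasure (X := fun _ => X) μ fun n =>
    K.comap (fun x : (i : Finset.Iic n) → X => x ⟨n, Finset.mem_Iic.2 le_rfl⟩)
      (measurable_pi_apply _)

/-- `n⁻¹ 𝔼[(∑_{k=1}^n (f(X_k) - μ(f)))²] ∈ [0, ∞]` for the chain with transition `K` started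
from `μ` (a stationary chain, when `K` is `μ`-invariant). -/
noncomputable def scaledSquareMean (K : Kernel X X) [IsMarkovKernel K] (μ : Measure X)
    (f : X → ℝ) (n : ℕ) : ℝ≥0∞ :=
  (∫⁻ ω, ENNReal.ofReal ((∑ k ∈ Finset.Icc 1 n, (f (ω k) - ∫ x, f x ∂μ)) ^ 2) ∂(chainLaw K μ))
    / (n : ℝ≥0∞)

/-- The asymptotic variance `var(K, f)` exists: the defining limit exists in `[0, ∞]`. -/
def AsymVarExists (K : Kernel X X) [IsMarkovKernel K] (μ : Measure X) (f : X → ℝ) : Prop :=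
  ∃ v : ℝ≥0∞, Tendsto (scaledSquareMean K μ f) atTop (𝓝 v)

/-- The asymptotic variance `var(K, f) ∈ [0, ∞]` of the `μ`-invariant kernel `K`, written as an
upper limit; it is the limit of `scaledSquareMean K μ f` whenever `AsymVarExists K μ f`. -/
noncomputable def asymVar (K : Kernel X X) [IsMarkovKernel K] (μ : Measure X) (f : X → ℝ) :
    ℝ≥0∞ :=
  limsup (scaledSquareMean K μ f) atTop

/-- Propose from `Q`, accept the move `x → x'` with probability `a x x'`, otherwise stay:
`Q_x(dx') a(x, x') + [1 - α(x)] δ_x(dx')` with `α(x) = ∫ a(x, x') Q_x(dx')`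
(for jointly measurable `a`). -/
noncomputable def acceptReject (Q : Kernel X X) [IsMarkovKernel Q] (a : X → X → ℝ≥0∞) :
    Kernel X X :=
  Q.withDensity a + (Kernel.id).withDensity fun x _ => 1 - ∫⁻ y, a x y ∂(Q x)

theorem acceptReject_apply (Q : Kernel X X) [IsMarkovKernel Q] {a : X → X → ℝ≥0∞}
    (ha : Measurable (Function.uncurry a)) (x : X) :
    acceptReject Q a x
      = (Q x).withDensity (a x) + (1 - ∫⁻ y, a x y ∂(Q x)) • Measure.dirac x := by
  have h : Measurable (Function.uncurry fun (x _ : X) => 1 - ∫⁻ y, a x y ∂(Q x)) := by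
    have h1 : Measurable fun x => ∫⁻ y, a x y ∂(Q x) := ha.lintegral_kernel_prod_right'
    exact (measurable_const.sub h1).comp measurable_fst
  rw [acceptReject, FunLike.coe_add, Pi.add_apply, Kernel.withDensity_apply _ ha, Kernel.withDensity_apply _ h,
    Kernel.id_apply, withDensity_const]

theorem isMarkovKernel_acceptReject (Q : Kernel X X) [IsMarkovKernel Q] {a : X → X → ℝ≥0∞}
    (ha : Measurable (Function.uncurry a)) (ha1 : ∀ x y, a x y ≤ 1) :
    IsMarkovKernel (acceptReject Q a) := by
  refine ⟨fun x => ⟨?_⟩⟩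
  have h1 : ∫⁻ y, a x y ∂(Q x) ≤ 1 :=
    (lintegral_mono (ha1 x)).trans (by simp)
  rw [acceptReject_apply Q ha]
  simp [withDensity_apply, add_tsub_cancel_of_le h1]

/-- `(R, r)` is a version of the Metropolis-Hastings ratio
`r(x, x') = ν(dx') q_{x'}(dx) / (ν(dx) q_x(dx'))`. With `F(dx, dx') = ν(dx) q_x(dx')` and `Fᵀ` its
image under `(x, x') ↦ (x', x)`: `R` is a symmetric measurable set, `0 < r < ∞` on `R` is the
Radon-Nikodym derivative of `Fᵀ` with respect to `F` there (so that `F` and `Fᵀ` are equivalent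
on `R`), while `F` and `Fᵀ` are mutually singular off `R`, where `r = 0`. -/
structure IsMHRatio (q : Kernel X X) (ν : Measure X) (R : Set (X × X)) (r : X × X → ℝ≥0∞) :
    Prop where
  measurableSet : MeasurableSet R
  symmetric : ∀ x y, (x, y) ∈ R → (y, x) ∈ R
  measurable : Measurable r
  pos : ∀ z ∈ R, 0 < r z
  lt_top : ∀ z ∈ R, r z < ∞
  eq_zero : ∀ z, z ∉ R → r z = 0
  restrict_eq : ((ν ⊗ₘ q).map Prod.swap).restrict R = ((ν ⊗ₘ q).restrict R).withDensity r
  mutuallySingular :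
    ((ν ⊗ₘ q).restrict Rᶜ).MutuallySingular (((ν ⊗ₘ q).map Prod.swap).restrict Rᶜ)

/-- `P` is the Metropolis-Hastings kernel MH(`q → ν`) with proposal `q` and target `ν`: the
acceptance probability is `min{1, r(x, x')}` for some version of the ratio `r`. -/
def IsMetropolisHastings (q : Kernel X X) [IsMarkovKernel q] (ν : Measure X) (P : Kernel X X) :
    Prop :=
  ∃ (R : Set (X × X)) (r : X × X → ℝ≥0∞), IsMHRatio q ν R r ∧
    P = acceptReject q fun x x' => min 1 (r (x, x'))

/-- The delayed acceptance correction of `K` with weight `w`: the acceptance probability is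
`min{1, w(x') / w(x)}`. (The convention for `w x = 0` only concerns starting points in a null set
of the measure with density `w`.) -/
noncomputable def daCorrection (K : Kernel X X) [IsMarkovKernel K] (w : X → ℝ≥0) : Kernel X X :=
  acceptReject K fun x x' => min 1 ((w x' : ℝ≥0∞) / (w x : ℝ≥0∞))

/-- The function `w φ̄`, where `φ̄ = φ - ν(φ)`. -/
noncomputable def weightedCentred (w : X → ℝ≥0) (ν : Measure X) (φ : X → ℝ) : X → ℝ :=
  fun x => (w x : ℝ) * (φ x - ∫ y, φ y ∂ν)

end PeskunIS

/-! The functions `f₁ = w φ̄` in `L²(μ)` and `f₂ = φ̄` in `L²(ν)` represent the same functional: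
`μ(f₁ g) = ν(f₂ g)`. Both kernels are reversible, so they act as self-adjoint contractions `T` on
their `L²` spaces. For `0 ≤ x < 1`, `∑ x ^ k ⟪f, T ^ k f⟫ = ⟪f, (1 - x T)⁻¹ f⟫ = sup_g (2 ⟪f, g⟫ -
⟪g, (1 - x T) g⟫)`, and `⟪g, (1 - x T) g⟫` is `1 - x` times the squared norm plus `x` times the
Dirichlet form. Hence, if the measure and the Dirichlet form of one chain are at most `c` times
those of the other, the resolvent values are ordered in the opposite direction
(`abel_sum_le_of_form_le`). As `x ↑ 1`, twice the resolvent value tends to asymptotic variance plus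
variance, possibly `∞` (`exists_asymVar_limit`); no spectral theorem or ergodicity is involved.

The form comparison (`reversible_and_form_le`) concerns flows off the diagonal only. For delayed
acceptance the flow of `L` has density `min (w x) (w x')` with respect to that of `K`. For
Metropolis-Hastings the flow is the infimum of the proposal flow and its transpose, which is
monotone in the target. Part (i) uses `ν ≤ c μ`; part (ii) exchanges the two chains and uses `μ ≤
c⁻¹ ν`. -/

namespace PeskunIS

/-! ### Cesàro and Abel limits of autocovariance sums. -/

section Sequences

/-- A real sequence with the sign and monotonicity properties of the autocovariances
`k ↦ ⟪f, T ^ k f⟫` of a self-adjoint contraction `T`. -/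
structure IsReversibleAutocov (a : ℕ → ℝ) : Prop where
  even_nonneg : ∀ k, 0 ≤ a (2 * k)
  even_antitone : ∀ k, a (2 * (k + 1)) ≤ a (2 * k)
  abs_odd_le : ∀ k, |a (2 * k + 1)| ≤ a (2 * k)

namespace IsReversibleAutocov

variable {a : ℕ → ℝ} (ha : IsReversibleAutocov a)
include ha

theorem pair_nonneg (k : ℕ) : 0 ≤ a (2 * k) + a (2 * k + 1) := by
  have := neg_abs_le (a (2 * k + 1))
  linarith [ha.abs_odd_le k]

theorem even_le_zero (k : ℕ) : a (2 * k) ≤ a 0 := by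
  induction k with
  | zero => simp
  | succ k ih => exact (ha.even_antitone k).trans ih

theorem abs_le_zero (k : ℕ) : |a k| ≤ a 0 := by
  rcases Nat.even_or_odd' k with ⟨m, rfl | rfl⟩
  · rw [abs_of_nonneg (ha.even_nonneg m)]; exact ha.even_le_zero m
  · exact (ha.abs_odd_le m).trans (ha.even_le_zero m)

theorem summable_pow {x : ℝ} (hx0 : 0 ≤ x) (hx1 : x < 1) : Summable fun k => x ^ k * a k := by
  refine Summable.of_norm_bounded
    (g := fun k => x ^ k * a 0) ((summable_geometric_of_lt_one hx0 hx1).mul_right _) fun k => ?_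
  rw [norm_mul, norm_pow, Real.norm_of_nonneg hx0]
  exact mul_le_mul_of_nonneg_left (ha.abs_le_zero k) (by positivity)

omit ha in
theorem sum_range_two_mul (a : ℕ → ℝ) (m : ℕ) :
    ∑ k ∈ Finset.range (2 * m), a k = ∑ k ∈ Finset.range m, (a (2 * k) + a (2 * k + 1)) := by
  induction m with
  | zero => simp
  | succ m ih =>
    rw [mul_add, mul_one, Finset.sum_range_succ, Finset.sum_range_succ, ih, Finset.sum_range_succ]
    ring

theorem pair_sum_monotone :
    Monotone fun m => ∑ k ∈ Finset.range m, (a (2 * k) + a (2 * k + 1)) :=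
  monotone_nat_of_le_succ fun m => by
    rw [Finset.sum_range_succ]; linarith [ha.pair_nonneg m]

theorem pair_sum_le_sum_range (j : ℕ) :
    ∑ k ∈ Finset.range (j / 2), (a (2 * k) + a (2 * k + 1)) ≤ ∑ k ∈ Finset.range j, a k := by
  rcases Nat.even_or_odd' j with ⟨m, rfl | rfl⟩
  · rw [sum_range_two_mul]; simp
  · rw [Finset.sum_range_succ, sum_range_two_mul, show (2 * m + 1) / 2 = m by omega]
    linarith [ha.even_nonneg m]

theorem exists_tendsto_even : ∃ l, Tendsto (fun k => a (2 * k)) atTop (𝓝 l) :=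
  ⟨_, tendsto_atTop_ciInf (antitone_nat_of_succ_le ha.even_antitone)
    ⟨0, by rintro _ ⟨k, rfl⟩; exact ha.even_nonneg k⟩⟩

/-- The averages of two consecutive partial sums converge as soon as the even partial sums do. -/
theorem tendsto_sum_add_sum {D l : ℝ}
    (hD : Tendsto (fun m => ∑ k ∈ Finset.range m, (a (2 * k) + a (2 * k + 1))) atTop (𝓝 D))
    (hl : Tendsto (fun k => a (2 * k)) atTop (𝓝 l)) :
    Tendsto (fun j => (∑ k ∈ Finset.range j, a k + ∑ k ∈ Finset.range (j + 1), a k) / 2) atTop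
      (𝓝 (D + l / 2)) := by
  have hdiv : Tendsto (fun j : ℕ => j / 2) atTop atTop := Nat.tendsto_div_const_atTop (by norm_num)
  -- The partial sums themselves may oscillate, since `l` can be nonzero (periodic chains). Writing
  -- `D_m` for the pair sums, the averages lie between `D_m + a (2m) / 2` and `D_{m+1} + a (2m) /
  -- 2`, where `m = j / 2`.
  have h1 := (hD.comp hdiv).add ((hl.comp hdiv).div_const 2)
  have h2 := (((tendsto_add_atTop_iff_nat 1).2 hD).comp hdiv).add ((hl.comp hdiv).div_const 2)
  refine tendsto_of_tendsto_of_tendsto_of_le_of_le h1 h2 (fun j => ?_) (fun j => ?_) <;>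
    simp only [Function.comp_apply] <;>
    rcases Nat.even_or_odd' j with ⟨m, rfl | rfl⟩
  · simp only [Finset.sum_range_succ, sum_range_two_mul, show 2 * m / 2 = m by omega]
    linarith
  · simp only [Finset.sum_range_succ, sum_range_two_mul, show (2 * m + 1) / 2 = m by omega]
    linarith [ha.pair_nonneg m]
  · simp only [Finset.sum_range_succ, sum_range_two_mul, show 2 * m / 2 = m by omega]
    linarith [ha.pair_nonneg m]
  · simp only [Finset.sum_range_succ, sum_range_two_mul, show (2 * m + 1) / 2 = m by omega]
    linarith [ha.pair_nonneg m]

/-- With `S_j` the partial sums, `∑_{j<n} S_{j+1}` exceeds `∑_{j<n} (S_j + S_{j+1}) / 2` by `S_n /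
2`, and `S_n / n → 0` because `S_n` differs from a convergent average by the bounded term `a n / 2`.
-/
theorem tendsto_cesaro {V : ℝ}
    (hV : Tendsto (fun j => (∑ k ∈ Finset.range j, a k + ∑ k ∈ Finset.range (j + 1), a k) / 2)
      atTop (𝓝 V)) :
    Tendsto (fun n : ℕ => (n : ℝ)⁻¹ * ∑ j ∈ Finset.range n, ∑ k ∈ Finset.range (j + 1), a k) atTop
      (𝓝 V) := by
  have hlim : Tendsto (fun n : ℕ => (n : ℝ)⁻¹ * ((∑ k ∈ Finset.range n, a k) / 2)) atTop (𝓝 0) := by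
    have hinv : Tendsto (fun n : ℕ => (n : ℝ)⁻¹) atTop (𝓝 0) := tendsto_inv_atTop_nhds_zero_nat
    have h1 := hinv.mul ((hV.sub_const (0 : ℝ)))
    have h2 : Tendsto (fun n : ℕ => (n : ℝ)⁻¹ * (a n / 4)) atTop (𝓝 0) := by
      refine squeeze_zero_norm (a := fun n : ℕ => (n : ℝ)⁻¹ * (a 0 / 4)) (fun n => ?_) ?_
      · rw [norm_mul, norm_div, Real.norm_eq_abs (a n)]
        have := ha.abs_le_zero n
        simp only [norm_inv, RCLike.norm_natCast, Real.norm_ofNat]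
        gcongr
      · simpa using hinv.mul_const (a 0 / 4)
    have h3 := (h1.div_const 2).sub h2
    simp only [zero_mul, zero_div, sub_zero] at h3
    refine h3.congr fun n => ?_
    rw [Finset.sum_range_succ]
    ring
  have h := hV.cesaro.add hlim
  rw [add_zero] at h
  refine h.congr fun n => ?_
  rw [← mul_add]
  congr 1
  induction n with
  | zero => simp
  | succ n ih =>
    rw [Finset.sum_range_succ, Finset.sum_range_succ (fun j => ∑ k ∈ Finset.range (j + 1), a k),
      ← ih]
    rw [Finset.sum_range_succ (fun k => a k) n]
    ring

/-- Abel's limit theorem applies to the series `e` whose partial sums are the averages. Its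
generating function is `(1 + x) / 2` times that of `a`, and this factor tends to `1`. -/
theorem tendsto_abel {V : ℝ}
    (hV : Tendsto (fun j => (∑ k ∈ Finset.range j, a k + ∑ k ∈ Finset.range (j + 1), a k) / 2)
      atTop (𝓝 V)) :
    Tendsto (fun x : ℝ => ∑' k, x ^ k * a k) (𝓝[<] 1) (𝓝 V) := by
  let e : ℕ → ℝ := fun k => Nat.casesOn k (a 0 / 2) fun k => (a k + a (k + 1)) / 2
  have he : ∀ n, ∑ k ∈ Finset.range (n + 1), e k
      = (∑ k ∈ Finset.range n, a k + ∑ k ∈ Finset.range (n + 1), a k) / 2 := by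
    intro n
    induction n with
    | zero => simp [e]
    | succ n ih =>
      rw [Finset.sum_range_succ, ih, Finset.sum_range_succ _ (n + 1), Finset.sum_range_succ]
      simp only [e]
      ring
  have h1 : Tendsto (fun n => ∑ k ∈ Finset.range n, e k) atTop (𝓝 V) := by
    rw [← tendsto_add_atTop_iff_nat 1]
    exact hV.congr fun n => (he n).symm
  have h2 := Real.tendsto_tsum_powerSeries_nhdsWithin_lt h1
  have h3 : Tendsto (fun x : ℝ => 2 / (1 + x)) (𝓝[<] 1) (𝓝 1) := by
    have : ContinuousAt (fun x : ℝ => 2 / (1 + x)) 1 :=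
      ContinuousAt.div (by fun_prop) (by fun_prop) (by norm_num)
    have h := this.tendsto
    norm_num at h
    exact h.mono_left nhdsWithin_le_nhds
  have h4 := h3.mul h2
  rw [one_mul] at h4
  refine h4.congr' ?_
  have hIoo : Set.Ioo (0 : ℝ) 1 ∈ 𝓝[<] (1 : ℝ) := Ioo_mem_nhdsLT (by norm_num)
  filter_upwards [hIoo] with x hx
  have hs := ha.summable_pow hx.1.le hx.2
  have hs1 : Summable fun k => x ^ (k + 1) * a (k + 1) := (summable_nat_add_iff 1).2 hs
  have hsum : HasSum (fun k => e (k + 1) * x ^ (k + 1))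
      ((x * ∑' k, x ^ k * a k + ∑' k, x ^ (k + 1) * a (k + 1)) / 2) := by
    refine (((hs.hasSum.mul_left x).add hs1.hasSum).div_const 2).congr_fun ?_
    intro k
    simp only [e]
    ring
  have hz : ∑' k, x ^ k * a k = a 0 + ∑' k, x ^ (k + 1) * a (k + 1) := by
    rw [hs.tsum_eq_zero_add]; simp
  have : ∑' k, e k * x ^ k = (1 + x) / 2 * ∑' k, x ^ k * a k := by
    have hse : Summable fun k => e k * x ^ k :=
      (summable_nat_add_iff (f := fun k => e k * x ^ k) 1).1 hsum.summable
    rw [hse.tsum_eq_zero_add, hsum.tsum_eq, pow_zero, mul_one, show e 0 = a 0 / 2 from rfl]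
    linear_combination (-1 / 2) * hz
  rw [this]
  have : (1 + x) ≠ 0 := by linarith [hx.1]
  field_simp

theorem tendsto_cesaro_atTop
    (h : Tendsto (fun m => ∑ k ∈ Finset.range m, (a (2 * k) + a (2 * k + 1))) atTop atTop) :
    Tendsto (fun n : ℕ => (n : ℝ)⁻¹ * ∑ j ∈ Finset.range n, ∑ k ∈ Finset.range (j + 1), a k) atTop
      atTop := by
  have hdiv : Tendsto (fun j : ℕ => j / 2) atTop atTop := Nat.tendsto_div_const_atTop (by norm_num)
  have hS : Tendsto (fun j => ∑ k ∈ Finset.range j, a k) atTop atTop :=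
    tendsto_atTop_mono ha.pair_sum_le_sum_range (h.comp hdiv)
  have hS1 := (tendsto_add_atTop_iff_nat 1).2 hS
  refine tendsto_atTop.2 fun M => ?_
  -- Truncated at `M + 1`, the partial sums are eventually constant, so their Cesàro means converge
  -- to `M + 1`.
  have hmin : Tendsto (fun j => min (∑ k ∈ Finset.range (j + 1), a k) (M + 1)) atTop
      (𝓝 (M + 1)) :=
    tendsto_const_nhds.congr' (by
      filter_upwards [hS1.eventually_ge_atTop (M + 1)] with j hj
      rw [min_eq_right hj])
  filter_upwards [hmin.cesaro.eventually_const_le (show M < M + 1 by linarith)] with n hn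
  refine hn.trans ?_
  gcongr
  exact min_le_left _ _

/-- Since `a (2k) ≥ 0`, each pair of terms is at least `x ^ (2k+1)` times the nonnegative pair sum.
So finitely many pairs bound the series from below, and that bound is continuous at `x = 1`. -/
theorem tendsto_abel_atTop
    (h : Tendsto (fun m => ∑ k ∈ Finset.range m, (a (2 * k) + a (2 * k + 1))) atTop atTop) :
    Tendsto (fun x : ℝ => ∑' k, x ^ k * a k) (𝓝[<] 1) atTop := by
  refine tendsto_atTop.2 fun M => ?_
  obtain ⟨N, hN⟩ := (h.eventually_ge_atTop (M + 1)).exists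
  have hc : Tendsto (fun x : ℝ => ∑ k ∈ Finset.range N,
      x ^ (2 * k + 1) * (a (2 * k) + a (2 * k + 1))) (𝓝[<] 1)
      (𝓝 (∑ k ∈ Finset.range N, (a (2 * k) + a (2 * k + 1)))) := by
    have : Continuous fun x : ℝ => ∑ k ∈ Finset.range N,
      x ^ (2 * k + 1) * (a (2 * k) + a (2 * k + 1)) := by fun_prop
    have h := this.tendsto 1
    simp only [one_pow, one_mul] at h
    exact h.mono_left nhdsWithin_le_nhds
  have hIoo : Set.Ioo (0 : ℝ) 1 ∈ 𝓝[<] (1 : ℝ) := Ioo_mem_nhdsLT (by norm_num)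
  filter_upwards [hIoo, hc.eventually_const_le (show M < _ by linarith)] with x hx hM
  refine hM.trans ?_
  have hs := ha.summable_pow hx.1.le hx.2
  have he : Summable fun k => x ^ (2 * k) * a (2 * k) :=
    hs.comp_injective (mul_right_injective₀ (two_ne_zero' ℕ))
  have ho : Summable fun k => x ^ (2 * k + 1) * a (2 * k + 1) :=
    hs.comp_injective ((add_left_injective 1).comp (mul_right_injective₀ (two_ne_zero' ℕ)))
  have hle : ∀ k, x ^ (2 * k + 1) * (a (2 * k) + a (2 * k + 1))
      ≤ x ^ (2 * k) * a (2 * k) + x ^ (2 * k + 1) * a (2 * k + 1) := by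
    intro k
    have h1 : x ^ (2 * k + 1) ≤ x ^ (2 * k) :=
      pow_le_pow_of_le_one hx.1.le hx.2.le (Nat.le_succ _)
    nlinarith [ha.even_nonneg k]
  have h0 : ∀ k, 0 ≤ x ^ (2 * k + 1) * (a (2 * k) + a (2 * k + 1)) := fun k =>
    mul_nonneg (pow_nonneg hx.1.le _) (ha.pair_nonneg k)
  rw [← tsum_even_add_odd (f := fun k => x ^ k * a k) he ho, ← he.tsum_add ho]
  exact (Finset.sum_le_sum fun k _ => hle k).trans
    ((he.add ho).sum_le_tsum (Finset.range N) fun k _ => (h0 k).trans (hle k))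

/-- The Cesàro and the Abel means of the partial sums of a reversible autocovariance sequence have
the same limit, which may be infinite. -/
theorem tendsto_cesaro_abel :
    (∃ V : ℝ,
      Tendsto (fun n : ℕ => (n : ℝ)⁻¹ * ∑ j ∈ Finset.range n, ∑ k ∈ Finset.range (j + 1), a k)
        atTop (𝓝 V) ∧ Tendsto (fun x : ℝ => ∑' k, x ^ k * a k) (𝓝[<] 1) (𝓝 V)) ∨
    (Tendsto (fun n : ℕ => (n : ℝ)⁻¹ * ∑ j ∈ Finset.range n, ∑ k ∈ Finset.range (j + 1), a k)
        atTop atTop ∧ Tendsto (fun x : ℝ => ∑' k, x ^ k * a k) (𝓝[<] 1) atTop) := by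
  rcases tendsto_atTop_of_monotone ha.pair_sum_monotone with h | ⟨D, hD⟩
  · exact Or.inr ⟨ha.tendsto_cesaro_atTop h, ha.tendsto_abel_atTop h⟩
  · obtain ⟨l, hl⟩ := ha.exists_tendsto_even
    have hV := ha.tendsto_sum_add_sum hD hl
    exact Or.inl ⟨_, ha.tendsto_cesaro hV, ha.tendsto_abel hV⟩

end IsReversibleAutocov

end Sequences

/-- The Cesàro and Abel limits of a reversible autocovariance sequence, in `[0, ∞]`. -/
theorem IsReversibleAutocov.exists_ennreal_limit {a G : ℕ → ℝ} (ha : IsReversibleAutocov a)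
    (hG0 : ∀ n, 0 ≤ G n)
    (hG : ∀ n : ℕ, G n = 2 * ∑ j ∈ Finset.range n, ∑ k ∈ Finset.range (j + 1), a k - n * a 0) :
    ∃ v : ℝ≥0∞, Tendsto (fun n : ℕ => ENNReal.ofReal ((n : ℝ)⁻¹ * G n)) atTop (𝓝 v) ∧
      Tendsto (fun x : ℝ => ENNReal.ofReal (2 * ∑' k, x ^ k * a k)) (𝓝[<] 1)
        (𝓝 (v + ENNReal.ofReal (a 0))) := by
  have hev : ∀ᶠ n : ℕ in atTop,
      2 * ((n : ℝ)⁻¹ * ∑ j ∈ Finset.range n, ∑ k ∈ Finset.range (j + 1), a k) - a 0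
        = (n : ℝ)⁻¹ * G n := by
    filter_upwards [eventually_gt_atTop 0] with n hn
    have : (n : ℝ) ≠ 0 := by positivity
    rw [hG]
    field_simp
  have ha0 : 0 ≤ a 0 := ha.even_nonneg 0
  rcases ha.tendsto_cesaro_abel with ⟨V, hC, hA⟩ | ⟨hC, hA⟩
  · have h1 := ((hC.const_mul 2).sub_const (a 0)).congr' hev
    have h0 : 0 ≤ 2 * V - a 0 := ge_of_tendsto' h1 fun n => mul_nonneg (by positivity) (hG0 n)
    refine ⟨_, ENNReal.tendsto_ofReal h1, ?_⟩
    rw [← ENNReal.ofReal_add h0 ha0, sub_add_cancel]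
    exact ENNReal.tendsto_ofReal (hA.const_mul 2)
  · refine ⟨∞, ?_, ?_⟩
    · refine ENNReal.tendsto_ofReal_atTop.comp (Tendsto.congr' hev ?_)
      exact tendsto_atTop_add_const_right _ _ (hC.const_mul_atTop two_pos)
    · rw [top_add]
      exact ENNReal.tendsto_ofReal_atTop.comp (hA.const_mul_atTop two_pos)

/-! ### Self-adjoint contractions and comparison of resolvents. -/

section Hilbert

variable {H : Type*} [NormedAddCommGroup H] [InnerProductSpace ℝ H]

/-- The autocovariances `⟪f, T ^ k f⟫`. -/
noncomputable def autocov (T : H →L[ℝ] H) (f : H) (k : ℕ) : ℝ := inner ℝ f ((T ^ k) f)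

theorem norm_pow_apply_le {T : H →L[ℝ] H} (hT : ‖T‖ ≤ 1) (k : ℕ) (f : H) : ‖(T ^ k) f‖ ≤ ‖f‖ := by
  induction k with
  | zero => simp
  | succ k ih =>
    rw [pow_succ']
    exact (T.le_of_opNorm_le hT _).trans (by rwa [one_mul])

theorem inner_pow_comm {T : H →L[ℝ] H} (hs : ∀ x y, inner ℝ (T x) y = inner ℝ x (T y)) (k : ℕ) :
    ∀ x y, inner ℝ ((T ^ k) x) y = inner ℝ x ((T ^ k) y) := by
  induction k with
  | zero => simp
  | succ k ih =>
    intro x y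
    rw [pow_succ, mul_apply_eq_comp, ih, hs, ← mul_apply_eq_comp,
      ← pow_succ', pow_succ]

theorem autocov_zero (T : H →L[ℝ] H) (f : H) : autocov T f 0 = ‖f‖ ^ 2 := by
  simp [autocov]

/-- By self-adjointness the even terms are `‖T ^ k f‖ ^ 2` and the odd ones `⟪T ^ k f, T (T ^ k
f)⟫`; contraction does the rest. -/
theorem isReversibleAutocov_autocov {T : H →L[ℝ] H}
    (hs : ∀ x y, inner ℝ (T x) y = inner ℝ x (T y)) (hT : ‖T‖ ≤ 1) (f : H) :
    IsReversibleAutocov (autocov T f) := by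
  have heven : ∀ k, autocov T f (2 * k) = ‖(T ^ k) f‖ ^ 2 := fun k => by
    rw [autocov, two_mul, pow_add, mul_apply_eq_comp, ← inner_pow_comm hs,
      real_inner_self_eq_norm_sq]
  have hodd : ∀ k, autocov T f (2 * k + 1) = inner ℝ ((T ^ k) f) (T ((T ^ k) f)) := fun k => by
    rw [autocov, two_mul, add_assoc, pow_add, mul_apply_eq_comp, ← inner_pow_comm hs,
      pow_succ', mul_apply_eq_comp]
  have hle : ∀ g : H, ‖T g‖ ≤ ‖g‖ := fun g => by simpa using T.le_of_opNorm_le hT g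
  refine ⟨fun k => by rw [heven]; positivity, fun k => ?_, fun k => ?_⟩
  · rw [heven, heven, pow_succ' T, mul_apply_eq_comp]
    exact pow_le_pow_left₀ (norm_nonneg _) (hle _) 2
  · rw [heven, hodd]
    refine (abs_real_inner_le_norm _ _).trans ?_
    rw [sq]
    exact mul_le_mul_of_nonneg_left (hle _) (norm_nonneg _)

/-- Solution of the resolvent equation for a contraction. -/
theorem exists_resolvent [CompleteSpace H] {T : H →L[ℝ] H} (hT : ‖T‖ ≤ 1) (f : H) {x : ℝ}
    (hx0 : 0 ≤ x) (hx1 : x < 1) :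
    ∃ h : H, h - x • T h = f ∧ inner ℝ f h = ∑' k, x ^ k * autocov T f k := by
  have hs : Summable fun k => x ^ k • (T ^ k) f := by
    refine Summable.of_norm_bounded
      (g := fun k => x ^ k * ‖f‖) ((summable_geometric_of_lt_one hx0 hx1).mul_right _) fun k => ?_
    rw [norm_smul, norm_pow, Real.norm_of_nonneg hx0]
    exact mul_le_mul_of_nonneg_left (norm_pow_apply_le hT k f) (by positivity)
  refine ⟨∑' k, x ^ k • (T ^ k) f, ?_, ?_⟩
  · have h1 : x • T (∑' k, x ^ k • (T ^ k) f) = ∑' k, x ^ (k + 1) • (T ^ (k + 1)) f := by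
      rw [← smul_apply, ContinuousLinearMap.map_tsum _ hs]
      congr with k
      simp [pow_succ', smul_smul, mul_comm]
    rw [h1, hs.tsum_eq_zero_add]
    simp
  · have := (innerSL ℝ f).map_tsum hs
    simp only [innerSL_apply_apply, inner_smul_right] at this
    exact this

/-- Peskun-type comparison of resolvents: if the form of `T₂` is dominated by `c` times that of
`T₁`, then the Abel sums are ordered the other way around. -/
theorem abel_sum_le_of_form_le {H₁ H₂ : Type*} [NormedAddCommGroup H₁] [InnerProductSpace ℝ H₁]
    [CompleteSpace H₁] [NormedAddCommGroup H₂] [InnerProductSpace ℝ H₂] [CompleteSpace H₂]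
    {T₁ : H₁ →L[ℝ] H₁} {T₂ : H₂ →L[ℝ] H₂} (hT₁ : ‖T₁‖ ≤ 1) (hT₂ : ‖T₂‖ ≤ 1)
    (hs₂ : ∀ x y, inner ℝ (T₂ x) y = inner ℝ x (T₂ y)) {f₁ : H₁} {f₂ : H₂} {c : ℝ} (hc : 0 < c)
    (hJ : ∀ g : H₁, ∃ g' : H₂, inner ℝ f₁ g = inner ℝ f₂ g' ∧ ‖g'‖ ^ 2 ≤ c * ‖g‖ ^ 2 ∧
      ‖g'‖ ^ 2 - inner ℝ g' (T₂ g') ≤ c * (‖g‖ ^ 2 - inner ℝ g (T₁ g)))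
    {x : ℝ} (hx0 : 0 ≤ x) (hx1 : x < 1) :
    ∑' k, x ^ k * autocov T₁ f₁ k ≤ c * ∑' k, x ^ k * autocov T₂ f₂ k := by
  obtain ⟨g, hg, hgA⟩ := exists_resolvent hT₁ f₁ hx0 hx1
  obtain ⟨h, hh, hhA⟩ := exists_resolvent hT₂ f₂ hx0 hx1
  obtain ⟨g', hi, hn, hE⟩ := hJ g
  rw [← hgA, ← hhA]
  have e1 : inner ℝ f₁ g = ‖g‖ ^ 2 - x * inner ℝ g (T₁ g) := by
    rw [← hg, inner_sub_left, real_inner_self_eq_norm_sq, real_inner_smul_left,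
      real_inner_comm]
  have e2 : inner ℝ f₂ h = ‖h‖ ^ 2 - x * inner ℝ h (T₂ h) := by
    rw [← hh, inner_sub_left, real_inner_self_eq_norm_sq, real_inner_smul_left,
      real_inner_comm]
  have e3 : inner ℝ f₂ g' = inner ℝ h g' - x * inner ℝ h (T₂ g') := by
    rw [← hh, inner_sub_left, real_inner_smul_left, hs₂]
  have e4 : inner ℝ g' (T₂ h) = inner ℝ h (T₂ g') := by
    rw [← hs₂, real_inner_comm]
  -- The variational formula in completed-square form: `1 - x T₂` is a nonnegative form, evaluated
  -- at the distance of the trial vector `g'` from the optimal one, `c • h`.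
  have pos : 0 ≤ ‖g' - c • h‖ ^ 2 - x * inner ℝ (g' - c • h) (T₂ (g' - c • h)) := by
    have h1 := real_inner_le_norm (g' - c • h) (T₂ (g' - c • h))
    have h2 : ‖T₂ (g' - c • h)‖ ≤ ‖g' - c • h‖ :=
      (T₂.le_of_opNorm_le hT₂ _).trans_eq (one_mul _)
    nlinarith [norm_nonneg (g' - c • h), mul_le_mul_of_nonneg_left h2 (norm_nonneg (g' - c • h))]
  have expand : ‖g' - c • h‖ ^ 2 - x * inner ℝ (g' - c • h) (T₂ (g' - c • h))
      = (‖g'‖ ^ 2 - x * inner ℝ g' (T₂ g')) - 2 * c * inner ℝ f₂ g' + c ^ 2 * inner ℝ f₂ h := by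
    rw [norm_sub_sq_real, map_sub, map_smul, inner_sub_left, inner_sub_right, inner_sub_right,
      real_inner_smul_left, real_inner_smul_right, real_inner_smul_left, real_inner_smul_right,
      real_inner_smul_right, norm_smul, Real.norm_of_nonneg hc.le, e2, e3, e4,
      real_inner_comm h g']
    ring
  -- The form of `1 - x T` is `(1 - x) ‖·‖ ^ 2` plus `x` times the Dirichlet form, and both parts
  -- are dominated.
  have hQ : ‖g'‖ ^ 2 - x * inner ℝ g' (T₂ g') ≤ c * inner ℝ f₁ g := by
    rw [e1]
    nlinarith
  rw [expand, ← hi] at pos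
  have : 0 ≤ c * (c * inner ℝ f₂ h - inner ℝ f₁ g) := by nlinarith
  linarith [nonneg_of_mul_nonneg_right this hc]

end Hilbert

/-! ### Operators on `L²` defined by couplings, and their Dirichlet forms. -/

section Transition

variable {X : Type*} [MeasurableSpace X]

/-- The operator on `L²(μ)` with form `⟪g, T f⟫ = ∫ g(x) f(y) π(dx, dy)`, for a measure `π` with both
marginals equal to `μ`. -/
noncomputable def couplingOp {μ : Measure X} {π : Measure (X × X)}
    (h₁ : MeasurePreserving Prod.fst π μ) (h₂ : MeasurePreserving Prod.snd π μ) :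
    Lp ℝ 2 μ →L[ℝ] Lp ℝ 2 μ :=
  (Lp.compMeasurePreservingₗᵢ ℝ Prod.fst h₁).toContinuousLinearMap.adjoint ∘L
    (Lp.compMeasurePreservingₗᵢ ℝ Prod.snd h₂).toContinuousLinearMap

variable {μ : Measure X} {π : Measure (X × X)}
  (h₁ : MeasurePreserving Prod.fst π μ) (h₂ : MeasurePreserving Prod.snd π μ)

theorem inner_couplingOp (g f : Lp ℝ 2 μ) :
    inner ℝ g (couplingOp h₁ h₂ f) = inner ℝ (Lp.compMeasurePreservingₗᵢ ℝ Prod.fst h₁ g)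
      (Lp.compMeasurePreservingₗᵢ ℝ Prod.snd h₂ f) := by
  rw [couplingOp, ContinuousLinearMap.comp_apply, ContinuousLinearMap.adjoint_inner_right]
  rfl

theorem inner_compMeasurePreserving {Ω : Type*} [MeasurableSpace Ω] {P : Measure Ω} {u v : Ω → X}
    (hu : MeasurePreserving u P μ) (hv : MeasurePreserving v P μ) (g f : Lp ℝ 2 μ) :
    inner ℝ (Lp.compMeasurePreservingₗᵢ ℝ u hu g) (Lp.compMeasurePreservingₗᵢ ℝ v hv f)
      = ∫ ω, g (u ω) * f (v ω) ∂P := by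
  rw [L2.inner_def]
  refine integral_congr_ae ?_
  filter_upwards [Lp.coeFn_compMeasurePreserving g hu, Lp.coeFn_compMeasurePreserving f hv]
    with z hg hf
  simp only [Lp.compMeasurePreservingₗᵢ_apply_coe, Lp.compMeasurePreserving_val] at hg hf ⊢
  rw [hg, hf]
  simp [mul_comm]

theorem integrable_mul_comp {Ω : Type*} [MeasurableSpace Ω] {P : Measure Ω} {u v : Ω → X}
    (hu : MeasurePreserving u P μ) (hv : MeasurePreserving v P μ) (g f : Lp ℝ 2 μ) :
    Integrable (fun ω => g (u ω) * f (v ω)) P :=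
  ((Lp.memLp g).comp_measurePreserving hu).integrable_mul ((Lp.memLp f).comp_measurePreserving hv)

theorem norm_couplingOp_le : ‖couplingOp h₁ h₂‖ ≤ 1 := by
  refine (ContinuousLinearMap.opNorm_comp_le _ _).trans ?_
  rw [LinearIsometryEquiv.norm_map]
  exact mul_le_one₀ (LinearIsometry.norm_toContinuousLinearMap_le _) (norm_nonneg _)
    (LinearIsometry.norm_toContinuousLinearMap_le _)

theorem couplingOp_symm (hπ : π.map Prod.swap = π) (x y : Lp ℝ 2 μ) :
    inner ℝ (couplingOp h₁ h₂ x) y = inner ℝ x (couplingOp h₁ h₂ y) := by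
  have hswap : MeasurePreserving (MeasurableEquiv.prodComm : X × X ≃ᵐ X × X) π π :=
    ⟨MeasurableEquiv.prodComm.measurable, hπ⟩
  rw [real_inner_comm, inner_couplingOp, inner_couplingOp, inner_compMeasurePreserving,
    inner_compMeasurePreserving, ← hswap.integral_comp']
  refine integral_congr_ae (Eventually.of_forall fun z => ?_)
  exact mul_comm _ _

/-- The Dirichlet form of `couplingOp`. -/
theorem norm_sq_sub_inner_couplingOp (g : Lp ℝ 2 μ) :
    ENNReal.ofReal (‖g‖ ^ 2 - inner ℝ g (couplingOp h₁ h₂ g))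
      = 2⁻¹ * ∫⁻ z, ENNReal.ofReal ((g z.1 - g z.2) ^ 2) ∂π := by
  have h := norm_sub_sq_real (Lp.compMeasurePreservingₗᵢ ℝ Prod.fst h₁ g)
      (Lp.compMeasurePreservingₗᵢ ℝ Prod.snd h₂ g)
  rw [LinearIsometry.norm_map, LinearIsometry.norm_map, ← inner_couplingOp] at h
  have h' : ‖g‖ ^ 2 - inner ℝ g (couplingOp h₁ h₂ g)
      = 2⁻¹ * ‖Lp.compMeasurePreservingₗᵢ ℝ Prod.fst h₁ g
        - Lp.compMeasurePreservingₗᵢ ℝ Prod.snd h₂ g‖ ^ 2 := by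
    rw [h]; ring
  rw [h', ENNReal.ofReal_mul (by norm_num), ENNReal.ofReal_inv_of_pos two_pos, ENNReal.ofReal_ofNat,
    ← real_inner_self_eq_norm_sq, L2.inner_def, ofReal_integral_eq_lintegral_ofReal
      (L2.integrable_inner _ _) (Eventually.of_forall fun z => real_inner_self_nonneg)]
  congr 1
  refine lintegral_congr_ae ?_
  filter_upwards [Lp.coeFn_sub (Lp.compMeasurePreservingₗᵢ ℝ Prod.fst h₁ g)
      (Lp.compMeasurePreservingₗᵢ ℝ Prod.snd h₂ g), Lp.coeFn_compMeasurePreserving g h₁,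
      Lp.coeFn_compMeasurePreserving g h₂] with z hz hg hf
  rw [hz, Pi.sub_apply]
  simp only [Lp.compMeasurePreservingₗᵢ_apply_coe, Lp.compMeasurePreserving_val] at hg hf ⊢
  rw [hg, hf, real_inner_self_eq_norm_sq, Real.norm_eq_abs, sq_abs]
  rfl

end Transition

/-! ### Stationarity, the Markov property and second moments of the chain. -/

section Chain

variable {X : Type*} [MeasurableSpace X] {μ : Measure X} [IsProbabilityMeasure μ]
  {K : Kernel X X} [IsMarkovKernel K]

theorem measurePreserving_fst_compProd : MeasurePreserving Prod.fst (μ ⊗ₘ K) μ :=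
  ⟨measurable_fst, Measure.fst_compProd μ K⟩

theorem measurePreserving_snd_compProd (hK : Kernel.Invariant K μ) :
    MeasurePreserving Prod.snd (μ ⊗ₘ K) μ :=
  ⟨measurable_snd, (Measure.snd_compProd μ K).trans hK⟩

/-- The Markov operator of a `μ`-invariant kernel on `L²(μ)`. -/
noncomputable def markovOp (hK : Kernel.Invariant K μ) : Lp ℝ 2 μ →L[ℝ] Lp ℝ 2 μ :=
  couplingOp measurePreserving_fst_compProd (measurePreserving_snd_compProd hK)

/-- Testing against indicators identifies the weakly defined operator with integration against the
kernel, as needed for the Markov property. -/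
theorem markovOp_ae_eq (hK : Kernel.Invariant K μ) (g : Lp ℝ 2 μ) :
    markovOp hK g =ᵐ[μ] fun x => ∫ y, g y ∂(K x) := by
  have hg1 : Integrable (fun z : X × X => g z.2) (μ ⊗ₘ K) :=
    ((Lp.memLp g).comp_measurePreserving (measurePreserving_snd_compProd hK)).integrable one_le_two
  refine Integrable.ae_eq_of_forall_setIntegral_eq _ _ ((Lp.memLp _).integrable one_le_two)
    (Integrable.integral_compProd (f := fun z : X × X => g z.2) hg1) fun s hs _ => ?_
  rw [← L2.inner_indicatorConstLp_one (𝕜 := ℝ) hs (measure_ne_top μ s), markovOp, inner_couplingOp,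
    inner_compMeasurePreserving]
  have e1 : ∫ z, (indicatorConstLp 2 hs (measure_ne_top μ s) (1 : ℝ)) z.1 * g z.2 ∂(μ ⊗ₘ K)
      = ∫ z in s ×ˢ Set.univ, g z.2 ∂(μ ⊗ₘ K) := by
    rw [← integral_indicator (hs.prod MeasurableSet.univ)]
    refine integral_congr_ae ?_
    have := measurePreserving_fst_compProd (μ := μ) (K := K) |>.quasiMeasurePreserving.ae_eq_comp
      (indicatorConstLp_coeFn (p := 2) (hs := hs) (hμs := measure_ne_top μ s) (c := (1 : ℝ)))
    filter_upwards [this] with z hz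
    simp only [Function.comp_apply] at hz
    rw [hz]
    by_cases h : z.1 ∈ s <;> simp [Set.indicator, h]
  rw [e1, Measure.setIntegral_compProd hs MeasurableSet.univ hg1.integrableOn]
  simp

instance : IsProbabilityMeasure (chainLaw K μ) := by
  unfold chainLaw; infer_instance

/-- The one-step description of the path law from which both stationarity and the Markov property
are read off. -/
theorem map_chainLaw_step (n : ℕ) :
    (chainLaw K μ).map (Preorder.frestrictLe (π := fun _ => X) n) ⊗ₘ
      (K.comap (fun x : (i : Finset.Iic n) → X => x ⟨n, Finset.mem_Iic.2 le_rfl⟩)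
        (measurable_pi_apply _))
      = (chainLaw K μ).map fun ω => (Preorder.frestrictLe (π := fun _ => X) n ω, ω (n + 1)) :=
  Kernel.map_frestrictLe_trajMeasure_compProd_eq_map_trajMeasure

omit [IsProbabilityMeasure μ] in
theorem map_chainLaw_zero : (chainLaw K μ).map (fun ω => ω 0) = μ := by
  have h : (fun ω : ℕ → X => ω 0) = (fun x : (i : Finset.Iic 0) → X => x ⟨0, by simp⟩) ∘
      Preorder.frestrictLe (π := fun _ => X) 0 := rfl
  rw [h, ← Measure.map_map (measurable_pi_apply _) (by fun_prop), chainLaw, Kernel.trajMeasure,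
    Measure.map_comp _ _ (by fun_prop), Kernel.traj_map_frestrictLe, Kernel.partialTraj_self,
    Measure.id_comp, Measure.map_map (measurable_pi_apply _) (by fun_prop)]
  exact Measure.map_id

/-- The chain started from an invariant law is stationary. -/
theorem measurePreserving_eval_chainLaw (hK : Kernel.Invariant K μ) (n : ℕ) :
    MeasurePreserving (fun ω : ℕ → X => ω n) (chainLaw K μ) μ := by
  refine ⟨measurable_pi_apply _, ?_⟩
  induction n with
  | zero => exact map_chainLaw_zero
  | succ n ih =>
    have h := congrArg Measure.snd (map_chainLaw_step (K := K) (μ := μ) n)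
    rw [Measure.snd_compProd, Measure.snd, Measure.map_map measurable_snd (by fun_prop)] at h
    change _ = (chainLaw K μ).map fun ω => ω (n + 1) at h
    rw [← h]
    conv_rhs => rw [← hK.def, ← ih]
    ext s hs
    rw [Measure.bind_apply hs (Kernel.aemeasurable _), Measure.bind_apply hs (Kernel.aemeasurable _),
      lintegral_map (Kernel.measurable_coe _ hs) (by fun_prop),
      lintegral_map (Kernel.measurable_coe _ hs) (by fun_prop)]
    rfl

/-- Evaluation of a square-integrable function along the chain. -/
noncomputable def evalChain (hK : Kernel.Invariant K μ) (n : ℕ) :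
    Lp ℝ 2 μ →ₗᵢ[ℝ] Lp ℝ 2 (chainLaw K μ) :=
  Lp.compMeasurePreservingₗᵢ ℝ _ (measurePreserving_eval_chainLaw hK n)

/-- The Markov property. -/
theorem inner_evalChain_succ (hK : Kernel.Invariant K μ) {j n : ℕ} (hjn : j ≤ n)
    (f g : Lp ℝ 2 μ) :
    inner ℝ (evalChain hK j f) (evalChain hK (n + 1) g)
      = inner ℝ (evalChain hK j f) (evalChain hK n (markovOp hK g)) := by
  have hf : Measurable f := (Lp.stronglyMeasurable f).measurable
  have hg : Measurable g := (Lp.stronglyMeasurable g).measurable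
  have hj : j ∈ Finset.Iic n := Finset.mem_Iic.2 hjn
  have hF : Measurable fun z : ((i : Finset.Iic n) → X) × X => f (z.1 ⟨j, hj⟩) * g z.2 := by
    fun_prop
  have hm : Measurable fun ω : ℕ → X => (Preorder.frestrictLe (π := fun _ => X) n ω, ω (n + 1)) := by
    fun_prop
  have hint := integrable_mul_comp (measurePreserving_eval_chainLaw hK j)
    (measurePreserving_eval_chainLaw hK (n + 1)) f g
  have hint' : Integrable (fun z : ((i : Finset.Iic n) → X) × X => f (z.1 ⟨j, hj⟩) * g z.2)
      ((chainLaw K μ).map fun ω => (Preorder.frestrictLe (π := fun _ => X) n ω, ω (n + 1))) :=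
    (integrable_map_measure hF.aestronglyMeasurable hm.aemeasurable).2 hint
  have hk : StronglyMeasurable fun x => ∫ y, g y ∂(K x) :=
    (Lp.stronglyMeasurable g).integral_kernel
  unfold evalChain
  rw [inner_compMeasurePreserving, inner_compMeasurePreserving]
  calc ∫ ω, f (ω j) * g (ω (n + 1)) ∂(chainLaw K μ)
      = ∫ z, f (z.1 ⟨j, hj⟩) * g z.2 ∂((chainLaw K μ).map
          fun ω => (Preorder.frestrictLe (π := fun _ => X) n ω, ω (n + 1))) :=
        (integral_map hm.aemeasurable hF.aestronglyMeasurable).symm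
    _ = ∫ h, f (h ⟨j, hj⟩) * ∫ y, g y ∂(K (h ⟨n, Finset.mem_Iic.2 le_rfl⟩))
          ∂((chainLaw K μ).map (Preorder.frestrictLe (π := fun _ => X) n)) := by
        rw [← map_chainLaw_step] at hint' ⊢
        rw [Measure.integral_compProd hint']
        simp only [integral_const_mul, Kernel.comap_apply]
    _ = ∫ ω, f (ω j) * ∫ y, g y ∂(K (ω n)) ∂(chainLaw K μ) := by
        rw [integral_map (by fun_prop)]
        · rfl
        · exact ((hf.comp (measurable_pi_apply _)).mul
            (hk.measurable.comp (measurable_pi_apply _))).aestronglyMeasurable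
    _ = _ := by
        refine integral_congr_ae ?_
        filter_upwards [(measurePreserving_eval_chainLaw hK n).quasiMeasurePreserving.ae_eq_comp
          (markovOp_ae_eq hK g)] with ω hω
        simp only [Function.comp_apply] at hω
        rw [hω]

theorem inner_evalChain_add (hK : Kernel.Invariant K μ) (j m : ℕ) (f g : Lp ℝ 2 μ) :
    inner ℝ (evalChain hK j f) (evalChain hK (j + m) g) = inner ℝ f ((markovOp hK ^ m) g) := by
  induction m generalizing g with
  | zero => simp [LinearIsometry.inner_map_map]
  | succ m ih =>
    rw [← add_assoc, inner_evalChain_succ hK (Nat.le_add_right j m), ih, pow_succ,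
      mul_apply_eq_comp]

/-- Adding the term `n + 1` contributes `a 0 + 2 ∑_{k=1}^n a k = 2 ∑_{k=0}^n a k - a 0`, with `a`
the autocovariances. -/
theorem norm_sq_sum_evalChain (hK : Kernel.Invariant K μ) (f : Lp ℝ 2 μ) (n : ℕ) :
    ‖∑ k ∈ Finset.Icc 1 n, evalChain hK k f‖ ^ 2
      = 2 * ∑ j ∈ Finset.range n, ∑ k ∈ Finset.range (j + 1), autocov (markovOp hK) f k
        - n * autocov (markovOp hK) f 0 := by
  induction n with
  | zero => simp
  | succ n ih =>
    have hcross : inner ℝ (∑ k ∈ Finset.Icc 1 n, evalChain hK k f) (evalChain hK (n + 1) f)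
        = ∑ k ∈ Finset.range n, autocov (markovOp hK) f (k + 1) := by
      rw [sum_inner, ← Finset.sum_range_reflect, Finset.sum_bij' (fun k _ => k - 1) (fun k _ => k + 1)]
      · intro k hk; simp at hk ⊢; omega
      · intro k hk; simp at hk ⊢; omega
      · intro k hk; simp at hk ⊢; omega
      · intro k hk; simp
      · intro k hk
        simp only [Finset.mem_Icc] at hk
        rw [show n + 1 = k + (n - 1 - (k - 1) + 1) by omega, inner_evalChain_add]
        rfl
    rw [Finset.sum_Icc_succ_top (by omega), norm_add_sq_real, ih, hcross,
      LinearIsometry.norm_map, Finset.sum_range_succ _ n, Finset.sum_range_succ' _ n, autocov_zero]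
    push_cast
    ring

/-- The scaled second moments in terms of the `L²` theory. -/
theorem scaledSquareMean_eq (hK : Kernel.Invariant K μ) {f : X → ℝ}
    (hf : MemLp (fun x => f x - ∫ y, f y ∂μ) 2 μ) {n : ℕ} (hn : 0 < n) :
    scaledSquareMean K μ f n
      = ENNReal.ofReal ((n : ℝ)⁻¹ * ‖∑ k ∈ Finset.Icc 1 n, evalChain hK k (hf.toLp _)‖ ^ 2) := by
  rw [scaledSquareMean, ENNReal.ofReal_mul (by positivity), ENNReal.ofReal_inv_of_pos (by positivity),
    ENNReal.ofReal_natCast, ENNReal.div_eq_inv_mul, ← real_inner_self_eq_norm_sq, L2.inner_def,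
    ofReal_integral_eq_lintegral_ofReal (L2.integrable_inner _ _)
      (Eventually.of_forall fun z => real_inner_self_nonneg)]
  congr 1
  refine lintegral_congr_ae ?_
  have h1 : ∀ᵐ ω ∂(chainLaw K μ), ∀ k,
      (evalChain hK k (hf.toLp _) : (ℕ → X) → ℝ) ω = f (ω k) - ∫ y, f y ∂μ := by
    refine ae_all_iff.2 fun k => ?_
    have hk := measurePreserving_eval_chainLaw hK k
    filter_upwards [Lp.coeFn_compMeasurePreserving (hf.toLp _) hk,
      hk.quasiMeasurePreserving.ae_eq_comp hf.coeFn_toLp] with ω h h'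
    exact h.trans h'
  filter_upwards [h1, Lp.coeFn_finsetSum (Finset.Icc 1 n) fun k => evalChain hK k (hf.toLp _)]
    with ω h h'
  rw [h', real_inner_self_eq_norm_sq, Real.norm_eq_abs, sq_abs]
  simp only [Finset.sum_apply, h]

omit [IsProbabilityMeasure μ] in
theorem evariance_eq_ofReal_norm {f : X → ℝ} (hf : MemLp (fun x => f x - ∫ y, f y ∂μ) 2 μ) :
    evariance f μ = ENNReal.ofReal (‖hf.toLp _‖ ^ 2) := by
  rw [evariance_eq_lintegral_ofReal, ← real_inner_self_eq_norm_sq, L2.inner_def,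
    ofReal_integral_eq_lintegral_ofReal (L2.integrable_inner _ _)
      (Eventually.of_forall fun z => real_inner_self_nonneg)]
  refine lintegral_congr_ae ?_
  filter_upwards [hf.coeFn_toLp] with x hx
  rw [hx, real_inner_self_eq_norm_sq, Real.norm_eq_abs, sq_abs]

end Chain

/-! ### From comparison of forms to comparison of asymptotic variances. -/

section Comparison

variable {X : Type*} [MeasurableSpace X]

theorem inner_couplingOp_self_le {μ : Measure X} {π : Measure (X × X)}
    (h₁ : MeasurePreserving Prod.fst π μ) (h₂ : MeasurePreserving Prod.snd π μ) (g : Lp ℝ 2 μ) :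
    inner ℝ g (couplingOp h₁ h₂ g) ≤ ‖g‖ ^ 2 := by
  refine (real_inner_le_norm _ _).trans ?_
  rw [sq]
  exact mul_le_mul_of_nonneg_left
    (((couplingOp h₁ h₂).le_of_opNorm_le (norm_couplingOp_le h₁ h₂) g).trans_eq (one_mul _))
    (norm_nonneg _)

theorem ofReal_norm_sq_Lp {μ : Measure X} (g : Lp ℝ 2 μ) :
    ENNReal.ofReal (‖g‖ ^ 2) = ∫⁻ x, ENNReal.ofReal (g x ^ 2) ∂μ := by
  rw [← real_inner_self_eq_norm_sq, L2.inner_def,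
    ofReal_integral_eq_lintegral_ofReal (L2.integrable_inner _ _)
      (Eventually.of_forall fun z => real_inner_self_nonneg)]
  simp only [real_inner_self_eq_norm_sq, Real.norm_eq_abs, sq_abs]

theorem invariant_of_map_swap {μ : Measure X} [IsProbabilityMeasure μ] {K : Kernel X X}
    [IsMarkovKernel K] (h : (μ ⊗ₘ K).map Prod.swap = μ ⊗ₘ K) : Kernel.Invariant K μ := by
  have h1 := congrArg Measure.snd h
  rw [Measure.snd_compProd, Measure.snd, Measure.map_map measurable_snd measurable_swap] at h1
  exact h1.symm.trans (Measure.fst_compProd μ K)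

/-- Existence of the asymptotic variance of a reversible kernel, and its expression as a limit of
resolvents. -/
theorem exists_asymVar_limit {μ : Measure X} [IsProbabilityMeasure μ] {K : Kernel X X}
    [IsMarkovKernel K] (hK : (μ ⊗ₘ K).map Prod.swap = μ ⊗ₘ K) {f : X → ℝ}
    (hf : MemLp (fun x => f x - ∫ y, f y ∂μ) 2 μ) :
    AsymVarExists K μ f ∧
      Tendsto (fun x : ℝ => ENNReal.ofReal
          (2 * ∑' k, x ^ k * autocov (markovOp (invariant_of_map_swap hK)) (hf.toLp _) k))
        (𝓝[<] 1) (𝓝 (asymVar K μ f + evariance f μ)) := by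
  have ha := isReversibleAutocov_autocov
    (couplingOp_symm measurePreserving_fst_compProd
      (measurePreserving_snd_compProd (invariant_of_map_swap hK)) hK)
    (norm_couplingOp_le _ _) (hf.toLp _)
  obtain ⟨v, hv, hA⟩ := ha.exists_ennreal_limit
    (G := fun n => ‖∑ k ∈ Finset.Icc 1 n, evalChain (invariant_of_map_swap hK) k (hf.toLp _)‖ ^ 2)
    (fun n => by positivity) fun n => norm_sq_sum_evalChain _ _ n
  have hv' : Tendsto (scaledSquareMean K μ f) atTop (𝓝 v) :=
    hv.congr' (by
      filter_upwards [eventually_gt_atTop 0] with n hn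
      exact (scaledSquareMean_eq _ hf hn).symm)
  refine ⟨⟨v, hv'⟩, ?_⟩
  rw [asymVar, hv'.limsup_eq, evariance_eq_ofReal_norm hf]
  rw [autocov_zero] at hA
  exact hA

/-- If the target and the Dirichlet form of `(K₂, μ₂)` are dominated by `c` times those of
`(K₁, μ₁)`, then the asymptotic variances of functions inducing the same functional are ordered. -/
theorem asymVar_add_evariance_le {μ₁ μ₂ : Measure X} [IsProbabilityMeasure μ₁]
    [IsProbabilityMeasure μ₂] {K₁ K₂ : Kernel X X} [IsMarkovKernel K₁] [IsMarkovKernel K₂]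
    (hK₁ : (μ₁ ⊗ₘ K₁).map Prod.swap = μ₁ ⊗ₘ K₁) (hK₂ : (μ₂ ⊗ₘ K₂).map Prod.swap = μ₂ ⊗ₘ K₂)
    {c : ℝ≥0} (hc : c ≠ 0) (hle : μ₂ ≤ (c : ℝ≥0∞) • μ₁)
    (hform : ∀ F : X × X → ℝ≥0∞, Measurable F → (∀ x, F (x, x) = 0) →
      ∫⁻ z, F z ∂(μ₂ ⊗ₘ K₂) ≤ c * ∫⁻ z, F z ∂(μ₁ ⊗ₘ K₁))
    {f₁ f₂ : X → ℝ} (hf₁ : MemLp (fun x => f₁ x - ∫ y, f₁ y ∂μ₁) 2 μ₁)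
    (hf₂ : MemLp (fun x => f₂ x - ∫ y, f₂ y ∂μ₂) 2 μ₂)
    (hinner : ∀ g : X → ℝ, Measurable g → ∫ x, (f₁ x - ∫ y, f₁ y ∂μ₁) * g x ∂μ₁
      = ∫ x, (f₂ x - ∫ y, f₂ y ∂μ₂) * g x ∂μ₂) :
    asymVar K₁ μ₁ f₁ + evariance f₁ μ₁ ≤ c * (asymVar K₂ μ₂ f₂ + evariance f₂ μ₂) := by
  have hi₁ := invariant_of_map_swap hK₁
  have hi₂ := invariant_of_map_swap hK₂
  have hJ : ∀ g : Lp ℝ 2 μ₁, ∃ g' : Lp ℝ 2 μ₂,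
      inner ℝ (hf₁.toLp _) g = inner ℝ (hf₂.toLp _) g' ∧ ‖g'‖ ^ 2 ≤ (c : ℝ) * ‖g‖ ^ 2 ∧
      ‖g'‖ ^ 2 - inner ℝ g' (markovOp hi₂ g') ≤ c * (‖g‖ ^ 2 - inner ℝ g (markovOp hi₁ g)) := by
    intro g
    have hg : Measurable g := (Lp.stronglyMeasurable g).measurable
    have hg2 : MemLp g 2 μ₂ := (Lp.memLp g).of_measure_le_smul ENNReal.coe_ne_top hle
    have hae := hg2.coeFn_toLp
    -- The trial vector is the same function `g`, read modulo `μ₂`; it is square-integrable there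
    -- because `μ₂ ≤ c μ₁`.
    refine ⟨hg2.toLp g, ?_, ?_, ?_⟩
    · rw [L2.inner_def, L2.inner_def]
      have e1 : ∫ x, inner ℝ (hf₁.toLp _ x) (g x) ∂μ₁
          = ∫ x, (f₁ x - ∫ y, f₁ y ∂μ₁) * g x ∂μ₁ := by
        refine integral_congr_ae ?_
        filter_upwards [hf₁.coeFn_toLp] with x hx
        rw [hx]
        exact mul_comm _ _
      have e2 : ∫ x, inner ℝ (hf₂.toLp _ x) (hg2.toLp g x) ∂μ₂
          = ∫ x, (f₂ x - ∫ y, f₂ y ∂μ₂) * g x ∂μ₂ := by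
        refine integral_congr_ae ?_
        filter_upwards [hf₂.coeFn_toLp, hae] with x hx hx'
        rw [hx, hx']
        exact mul_comm _ _
      rw [e1, e2, hinner g hg]
    · rw [← ENNReal.ofReal_le_ofReal_iff (by positivity), ENNReal.ofReal_mul c.coe_nonneg,
        ofReal_norm_sq_Lp, ofReal_norm_sq_Lp, ENNReal.ofReal_coe_nnreal]
      calc ∫⁻ x, ENNReal.ofReal (hg2.toLp g x ^ 2) ∂μ₂ = ∫⁻ x, ENNReal.ofReal (g x ^ 2) ∂μ₂ :=
            lintegral_congr_ae (by filter_upwards [hae] with x hx; rw [hx])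
        _ ≤ ∫⁻ x, ENNReal.ofReal (g x ^ 2) ∂((c : ℝ≥0∞) • μ₁) := lintegral_mono' hle le_rfl
        _ = _ := lintegral_smul_measure _ _
    · have h0 : 0 ≤ (c : ℝ) * (‖g‖ ^ 2 - inner ℝ g (markovOp hi₁ g)) :=
        mul_nonneg c.coe_nonneg (sub_nonneg.2 (inner_couplingOp_self_le _ _ g))
      rw [← ENNReal.ofReal_le_ofReal_iff h0, ENNReal.ofReal_mul c.coe_nonneg, markovOp, markovOp,
        norm_sq_sub_inner_couplingOp, norm_sq_sub_inner_couplingOp, ENNReal.ofReal_coe_nnreal,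
        mul_left_comm]
      gcongr
      -- The squared increment of `g` vanishes on the diagonal, so holding probabilities play no
      -- role.
      refine le_trans (le_of_eq ?_)
        (hform (fun z => ENNReal.ofReal ((g z.1 - g z.2) ^ 2)) (by fun_prop) (by simp))
      refine lintegral_congr_ae ?_
      filter_upwards [(measurePreserving_fst_compProd (μ := μ₂)
        (K := K₂)).quasiMeasurePreserving.ae_eq_comp hae,
        (measurePreserving_snd_compProd hi₂).quasiMeasurePreserving.ae_eq_comp hae] with z h1 h2
      simp only [Function.comp_apply] at h1 h2
      rw [h1, h2]
  have h1 := (exists_asymVar_limit hK₁ hf₁).2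
  have h2 := ENNReal.Tendsto.const_mul (exists_asymVar_limit hK₂ hf₂).2
    (Or.inr (ENNReal.coe_ne_top (r := c)))
  refine le_of_tendsto_of_tendsto h1 h2 ?_
  have hIoo : Set.Ioo (0 : ℝ) 1 ∈ 𝓝[<] (1 : ℝ) := Ioo_mem_nhdsLT (by norm_num)
  filter_upwards [hIoo] with x hx
  rw [← ENNReal.ofReal_coe_nnreal, ← ENNReal.ofReal_mul c.coe_nonneg]
  refine ENNReal.ofReal_le_ofReal ?_
  have := abel_sum_le_of_form_le (T₁ := markovOp hi₁) (T₂ := markovOp hi₂)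
    (norm_couplingOp_le _ _) (norm_couplingOp_le _ _)
    (couplingOp_symm _ _ hK₂) (NNReal.coe_pos.2 (pos_iff_ne_zero.2 hc)) hJ hx.1.le hx.2
  linarith

end Comparison

/-! ### Accepted flows and their symmetry. -/

section AcceptReject

variable {X : Type*} [MeasurableSpace X]

theorem lintegral_compProd_acceptReject {μ : Measure X} [IsProbabilityMeasure μ] {Q : Kernel X X}
    [IsMarkovKernel Q] {a : X → X → ℝ≥0∞} (ha : Measurable (Function.uncurry a))
    [IsMarkovKernel (acceptReject Q a)] {F : X × X → ℝ≥0∞} (hF : Measurable F) :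
    ∫⁻ z, F z ∂(μ ⊗ₘ acceptReject Q a)
      = ∫⁻ z, F z ∂((μ ⊗ₘ Q).withDensity (Function.uncurry a))
        + ∫⁻ x, (1 - ∫⁻ y, a x y ∂(Q x)) * F (x, x) ∂μ := by
  have hFx : ∀ x, Measurable fun y => F (x, y) := fun x => hF.comp measurable_prodMk_left
  have hax : ∀ x, Measurable (a x) := fun x => ha.comp measurable_prodMk_left
  rw [Measure.lintegral_compProd hF, lintegral_withDensity_eq_lintegral_mul _ ha hF,
    Measure.lintegral_compProd (ha.mul hF), ← lintegral_add_left (by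
      exact Measurable.lintegral_kernel_prod_right' (ha.mul hF))]
  refine lintegral_congr fun x => ?_
  rw [acceptReject_apply Q ha, lintegral_add_measure, lintegral_smul_measure,
    lintegral_dirac' _ (hFx x), lintegral_withDensity_eq_lintegral_mul _ (hax x) (hFx x)]
  rfl

theorem lintegral_compProd_acceptReject_of_diag {μ : Measure X} [IsProbabilityMeasure μ]
    {Q : Kernel X X} [IsMarkovKernel Q] {a : X → X → ℝ≥0∞} (ha : Measurable (Function.uncurry a))
    [IsMarkovKernel (acceptReject Q a)] {F : X × X → ℝ≥0∞} (hF : Measurable F)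
    (hF0 : ∀ x, F (x, x) = 0) :
    ∫⁻ z, F z ∂(μ ⊗ₘ acceptReject Q a)
      = ∫⁻ z, F z ∂((μ ⊗ₘ Q).withDensity (Function.uncurry a)) := by
  simp [lintegral_compProd_acceptReject ha hF, hF0]

/-- Rejection only adds mass on the diagonal, which the swap fixes, so detailed balance need only be
checked on the accepted flow. -/
theorem map_swap_compProd_acceptReject {μ : Measure X} [IsProbabilityMeasure μ]
    {Q : Kernel X X} [IsMarkovKernel Q] {a : X → X → ℝ≥0∞} (ha : Measurable (Function.uncurry a))
    [IsMarkovKernel (acceptReject Q a)]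
    (h : ((μ ⊗ₘ Q).withDensity (Function.uncurry a)).map Prod.swap
      = (μ ⊗ₘ Q).withDensity (Function.uncurry a)) :
    (μ ⊗ₘ acceptReject Q a).map Prod.swap = μ ⊗ₘ acceptReject Q a := by
  refine Measure.ext_of_lintegral _ fun F hF => ?_
  rw [lintegral_map hF measurable_swap, lintegral_compProd_acceptReject ha hF,
    lintegral_compProd_acceptReject (F := fun z => F z.swap) ha (hF.comp measurable_swap)]
  conv_rhs => rw [← h, lintegral_map hF measurable_swap]
  rfl

/-- The accepted flow of a Metropolis-Hastings kernel is the infimum of the proposal flow and its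
transpose. -/
theorem IsMHRatio.withDensity_eq_inf {q : Kernel X X} {μ : Measure X} {R : Set (X × X)}
    {r : X × X → ℝ≥0∞} (h : IsMHRatio q μ R r) :
    (μ ⊗ₘ q).withDensity (fun z => min 1 (r z)) = (μ ⊗ₘ q) ⊓ (μ ⊗ₘ q).map Prod.swap := by
  have hR := h.measurableSet
  have hr := h.measurable
  have key : ∀ s, MeasurableSet s → s ⊆ R →
      (μ ⊗ₘ q).map Prod.swap s = ∫⁻ z in s, r z ∂(μ ⊗ₘ q) := fun s hs hsR => by
    have := congrArg (fun m : Measure (X × X) => m s) h.restrict_eq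
    simp only [Measure.restrict_apply hs, withDensity_apply _ hs, Measure.restrict_restrict hs,
      Set.inter_eq_left.2 hsR] at this
    exact this
  refine le_antisymm (le_inf ?_ ?_) ?_
  · calc _ ≤ (μ ⊗ₘ q).withDensity 1 := withDensity_mono (Eventually.of_forall fun z => min_le_left _ _)
      _ = _ := withDensity_one
  · refine Measure.le_iff.2 fun s hs => ?_
    rw [withDensity_apply _ hs]
    calc ∫⁻ z in s, min 1 (r z) ∂(μ ⊗ₘ q) ≤ ∫⁻ z in s, r z ∂(μ ⊗ₘ q) :=
          lintegral_mono fun z => min_le_right _ _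
      _ = ∫⁻ z in s, R.indicator r z ∂(μ ⊗ₘ q) := by
          congr with z
          by_cases hz : z ∈ R <;> simp [hz, h.eq_zero z]
      _ = ∫⁻ z in R ∩ s, r z ∂(μ ⊗ₘ q) := by
          rw [lintegral_indicator hR, Measure.restrict_restrict hR]
      _ = (μ ⊗ₘ q).map Prod.swap (R ∩ s) := (key _ (hR.inter hs) Set.inter_subset_left).symm
      _ ≤ _ := measure_mono Set.inter_subset_right
  -- Off `R` the infimum lies below two mutually singular measures, hence is zero. On `R` it is
  -- bounded by the transpose where `r ≤ 1` and by the flow itself where `r > 1`.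
  · set m := (μ ⊗ₘ q) ⊓ (μ ⊗ₘ q).map Prod.swap with hm
    have hm1 : m ≤ μ ⊗ₘ q := inf_le_left
    have hm2 : m ≤ (μ ⊗ₘ q).map Prod.swap := inf_le_right
    have hzero : m.restrict Rᶜ = 0 := by
      have hs := h.mutuallySingular.mono_ac
        (Measure.restrict_mono le_rfl hm1 : m.restrict Rᶜ ≤ _).absolutelyContinuous
        (Measure.restrict_mono le_rfl hm2 : m.restrict Rᶜ ≤ _).absolutelyContinuous
      exact (Measure.MutuallySingular.self_iff _).1 hs
    have hS : MeasurableSet {z | r z ≤ 1} := measurableSet_le hr measurable_const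
    refine Measure.le_iff.2 fun s hs => ?_
    rw [withDensity_apply _ hs, ← measure_inter_add_sdiff s hR, ← lintegral_inter_add_sdiff _ s hR]
    have h1 : m (s \ R) = 0 := by
      rw [Set.sdiff_eq, ← Measure.restrict_apply hs, hzero]; rfl
    rw [h1, ← measure_inter_add_sdiff (s ∩ R) hS, ← lintegral_inter_add_sdiff _ (s ∩ R) hS]
    refine add_le_add (add_le_add ?_ ?_) zero_le
    · refine (hm2 _).trans_eq ?_
      rw [key _ ((hs.inter hR).inter hS) (Set.inter_subset_left.trans Set.inter_subset_right)]
      refine setLIntegral_congr_fun ((hs.inter hR).inter hS) fun z hz => ?_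
      exact (min_eq_right hz.2).symm
    · refine (hm1 _).trans_eq ?_
      rw [← setLIntegral_one]
      refine setLIntegral_congr_fun ((hs.inter hR).diff hS) fun z hz => ?_
      exact (min_eq_left (not_le.1 hz.2).le).symm

theorem map_swap_map_swap (m : Measure (X × X)) : (m.map Prod.swap).map Prod.swap = m := by
  rw [Measure.map_map measurable_swap measurable_swap, Prod.swap_swap_eq, Measure.map_id]

theorem map_swap_inf_map_swap (m : Measure (X × X)) :
    (m ⊓ m.map Prod.swap).map Prod.swap = m ⊓ m.map Prod.swap := by
  have h : (m ⊓ m.map Prod.swap).map Prod.swap ≤ m ⊓ m.map Prod.swap := by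
    refine le_inf ?_ (Measure.map_mono inf_le_left measurable_swap)
    calc _ ≤ (m.map Prod.swap).map Prod.swap := Measure.map_mono inf_le_right measurable_swap
      _ = m := map_swap_map_swap m
  refine le_antisymm h ?_
  have h' := Measure.map_mono h measurable_swap
  rwa [map_swap_map_swap] at h'

/-- After dividing by `c`, this is the universal property of the infimum together with monotonicity
of the swap. -/
theorem inf_map_swap_le_smul {m₁ m₂ : Measure (X × X)} {c : ℝ≥0} (hc : c ≠ 0)
    (h : m₂ ≤ (c : ℝ≥0∞) • m₁) :
    m₂ ⊓ m₂.map Prod.swap ≤ (c : ℝ≥0∞) • (m₁ ⊓ m₁.map Prod.swap) := by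
  have hc0 : (c : ℝ≥0∞) ≠ 0 := by simpa using hc
  have hcancel : ∀ a b : Measure (X × X), a ≤ (c : ℝ≥0∞) • b ↔ (c : ℝ≥0∞)⁻¹ • a ≤ b := by
    intro a b
    simp only [Measure.le_iff, Measure.smul_apply, smul_eq_mul]
    refine forall₂_congr fun s _ => ?_
    rw [← ENNReal.div_eq_inv_mul, ENNReal.div_le_iff_le_mul (Or.inl hc0)
      (Or.inl ENNReal.coe_ne_top), mul_comm]
  rw [hcancel]
  refine le_inf ((hcancel _ _).1 (inf_le_left.trans h)) ((hcancel _ _).1 (inf_le_right.trans ?_))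
  rw [← Measure.map_smul]
  exact Measure.map_mono h measurable_swap

theorem compProd_mono_left {μ ν : Measure X} [SFinite μ] [SFinite ν] {q : Kernel X X}
    [IsMarkovKernel q] (h : μ ≤ ν) : μ ⊗ₘ q ≤ ν ⊗ₘ q :=
  Measure.le_iff.2 fun s hs => by
    rw [Measure.compProd_apply hs, Measure.compProd_apply hs]
    exact lintegral_mono' h le_rfl

theorem compProd_withDensity_left {μ : Measure X} [IsProbabilityMeasure μ] {K : Kernel X X}
    [IsMarkovKernel K] {w : X → ℝ≥0} (hw : Measurable w) :
    (μ.withDensity fun x => (w x : ℝ≥0∞)) ⊗ₘ K = (μ ⊗ₘ K).withDensity fun z => (w z.1 : ℝ≥0∞) := by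
  ext s hs
  have hw' : Measurable fun x => (w x : ℝ≥0∞) := hw.coe_nnreal_ennreal
  have hF : Measurable (s.indicator fun z : X × X => (w z.1 : ℝ≥0∞)) :=
    (hw'.comp measurable_fst).indicator hs
  rw [Measure.compProd_apply hs, withDensity_apply _ hs, ← lintegral_indicator hs,
    Measure.lintegral_compProd hF, lintegral_withDensity_eq_lintegral_mul _ hw'
      (Kernel.measurable_kernel_prodMk_left hs)]
  refine lintegral_congr fun x => ?_
  have : (fun y => s.indicator (fun z : X × X => (w z.1 : ℝ≥0∞)) (x, y))
      = (Prod.mk x ⁻¹' s).indicator fun _ => (w x : ℝ≥0∞) := by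
    ext y; rfl
  rw [this, lintegral_indicator_const (measurable_prodMk_left hs)]
  rfl

theorem map_swap_withDensity {m : Measure (X × X)} (hm : m.map Prod.swap = m) {f : X × X → ℝ≥0∞}
    (hf : Measurable f) (hfs : ∀ z, f z.swap = f z) :
    (m.withDensity f).map Prod.swap = m.withDensity f := by
  ext s hs
  rw [Measure.map_apply measurable_swap hs, withDensity_apply _ (measurable_swap hs),
    withDensity_apply _ hs]
  conv_rhs => rw [← hm, setLIntegral_map hs hf measurable_swap]
  simp only [hfs]

theorem map_swap_of_isReversible {μ : Measure X} [IsProbabilityMeasure μ] {K : Kernel X X}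
    [IsMarkovKernel K] (h : Kernel.IsReversible K μ) : (μ ⊗ₘ K).map Prod.swap = μ ⊗ₘ K := by
  refine Measure.ext_prod fun {s t} hs ht => ?_
  rw [Measure.map_apply measurable_swap (hs.prod ht), Set.preimage_swap_prod,
    Measure.compProd_apply_prod ht hs, Measure.compProd_apply_prod hs ht, h ht hs]

theorem IsImportanceTriplet.eq_withDensity {μ ν : Measure X} [IsProbabilityMeasure μ]
    [IsProbabilityMeasure ν] {w : X → ℝ≥0} (h : IsImportanceTriplet μ ν w) :
    ν = μ.withDensity fun x => (w x : ℝ≥0∞) := by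
  rw [withDensity_congr_ae h.weight_ae_eq, Measure.withDensity_rnDeriv_eq _ _ h.absolutelyContinuous]

end AcceptReject

/-! ### Comparison of the Dirichlet forms of `K` and `L`. -/

section Forms

variable {X : Type*} [MeasurableSpace X]

theorem withDensity_le_smul {α : Type*} [MeasurableSpace α] {m : Measure α} {f : α → ℝ≥0∞}
    {c : ℝ≥0∞} (h : ∀ᵐ z ∂m, f z ≤ c) : m.withDensity f ≤ c • m := by
  rw [← withDensity_const]
  exact withDensity_mono h

theorem le_inv_smul_withDensity {α : Type*} [MeasurableSpace α] {m : Measure α} {f : α → ℝ≥0∞}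
    {c : ℝ≥0} (hc : c ≠ 0) (h : ∀ᵐ z ∂m, (c : ℝ≥0∞) ≤ f z) :
    m ≤ ((c⁻¹ : ℝ≥0) : ℝ≥0∞) • m.withDensity f := by
  calc m = ((c⁻¹ : ℝ≥0) : ℝ≥0∞) • m.withDensity fun _ => (c : ℝ≥0∞) := by
        rw [withDensity_const, smul_smul, ← ENNReal.coe_mul, inv_mul_cancel₀ hc, ENNReal.coe_one,
          one_smul]
    _ ≤ _ := by
        have := withDensity_mono h
        exact Measure.le_iff.2 fun s hs => by
          simp only [Measure.smul_apply, smul_eq_mul]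
          gcongr

/-- The flow of the delayed acceptance kernel off the diagonal. -/
theorem withDensity_daCorrection {μ : Measure X} [IsProbabilityMeasure μ] {K : Kernel X X}
    [IsMarkovKernel K] {w : X → ℝ≥0} (hw : Measurable w)
    (ha : Measurable (Function.uncurry fun x x' => min 1 ((w x' : ℝ≥0∞) / (w x : ℝ≥0∞)))) :
    ((μ.withDensity fun x => (w x : ℝ≥0∞)) ⊗ₘ K).withDensity
        (Function.uncurry fun x x' => min 1 ((w x' : ℝ≥0∞) / (w x : ℝ≥0∞)))
      = (μ ⊗ₘ K).withDensity fun z => min (w z.1 : ℝ≥0∞) (w z.2) := by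
  have hw1 : Measurable fun z : X × X => (w z.1 : ℝ≥0∞) :=
    hw.coe_nnreal_ennreal.comp measurable_fst
  rw [compProd_withDensity_left hw, ← withDensity_mul _ hw1 ha]
  congr with z
  simp only [Pi.mul_apply, Function.uncurry]
  -- Where `w x = 0` the density factor `w x` kills the quotient, whatever its conventional value.
  rcases eq_or_ne (w z.1) 0 with h | h
  · simp [h]
  · have h0 : (w z.1 : ℝ≥0∞) ≠ 0 := by simpa using h
    rw [mul_min, mul_one, ENNReal.mul_div_cancel h0 ENNReal.coe_ne_top]

/-- Reversibility of both kernels and the comparison of their Dirichlet forms. -/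
theorem reversible_and_form_le {μ ν : Measure X} [IsProbabilityMeasure μ] [IsProbabilityMeasure ν]
    {w : X → ℝ≥0} (hw : IsImportanceTriplet μ ν w) {K L : Kernel X X} [IsMarkovKernel K]
    [IsMarkovKernel L]
    (hKL : (Kernel.IsReversible K μ ∧ L = daCorrection K w) ∨
      (∃ (q : Kernel X X) (_ : IsMarkovKernel q),
        IsMetropolisHastings q μ K ∧ IsMetropolisHastings q ν L)) :
    (μ ⊗ₘ K).map Prod.swap = μ ⊗ₘ K ∧ (ν ⊗ₘ L).map Prod.swap = ν ⊗ₘ L ∧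
    (∀ c : ℝ≥0, c ≠ 0 → (∀ᵐ x ∂μ, w x ≤ c) → ∀ F : X × X → ℝ≥0∞, Measurable F →
      (∀ x, F (x, x) = 0) → ∫⁻ z, F z ∂(ν ⊗ₘ L) ≤ c * ∫⁻ z, F z ∂(μ ⊗ₘ K)) ∧
    (∀ c : ℝ≥0, c ≠ 0 → (∀ᵐ x ∂μ, c ≤ w x) → ∀ F : X × X → ℝ≥0∞, Measurable F →
      (∀ x, F (x, x) = 0) →
      ∫⁻ z, F z ∂(μ ⊗ₘ K) ≤ (c⁻¹ : ℝ≥0) * ∫⁻ z, F z ∂(ν ⊗ₘ L)) := by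
  have hν := hw.eq_withDensity
  have hwm := hw.measurable_weight
  rcases hKL with ⟨hK, rfl⟩ | ⟨q, hq, ⟨R, r, hr, rfl⟩, ⟨R', r', hr', rfl⟩⟩
  · have hKs := map_swap_of_isReversible hK
    have hKi := invariant_of_map_swap hKs
    have ha : Measurable (Function.uncurry fun x x' => min 1 ((w x' : ℝ≥0∞) / (w x : ℝ≥0∞))) := by
      unfold Function.uncurry; fun_prop
    have hmin : Measurable fun z : X × X => min (w z.1 : ℝ≥0∞) (w z.2) := by fun_prop
    have hd := withDensity_daCorrection (μ := μ) (K := K) hwm ha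
    rw [← hν] at hd
    have hLs := map_swap_withDensity hKs hmin fun z => min_comm _ _
    rw [← hd] at hLs
    unfold daCorrection at *
    refine ⟨hKs, map_swap_compProd_acceptReject ha hLs, fun c _ hc F hF hF0 => ?_,
      fun c hc0 hc F hF hF0 => ?_⟩ <;>
      rw [lintegral_compProd_acceptReject_of_diag ha hF hF0, hd, ← smul_eq_mul, ← lintegral_smul_measure]
    · refine lintegral_mono' (withDensity_le_smul ?_) le_rfl
      filter_upwards [(measurePreserving_fst_compProd (μ := μ) (K := K)).quasiMeasurePreserving.ae hc]
        with z hz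
      exact (min_le_left _ _).trans (ENNReal.coe_le_coe.2 hz)
    · refine lintegral_mono' (le_inv_smul_withDensity hc0 ?_) le_rfl
      -- The lower bound is needed at both endpoints; invariance makes the second marginal `μ` too.
      filter_upwards [(measurePreserving_fst_compProd (μ := μ) (K := K)).quasiMeasurePreserving.ae hc,
        (measurePreserving_snd_compProd hKi).quasiMeasurePreserving.ae hc] with z hz hz'
      exact le_min (ENNReal.coe_le_coe.2 hz) (ENNReal.coe_le_coe.2 hz')
  · have ha : ∀ {r : X × X → ℝ≥0∞}, Measurable r →
        Measurable (Function.uncurry fun x x' => min 1 (r (x, x'))) :=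
      fun h => measurable_const.min h
    have h1 : (μ ⊗ₘ q).withDensity (Function.uncurry fun x x' => min 1 (r (x, x'))) = _ :=
      hr.withDensity_eq_inf
    have h2 : (ν ⊗ₘ q).withDensity (Function.uncurry fun x x' => min 1 (r' (x, x'))) = _ :=
      hr'.withDensity_eq_inf
    have hsm : SFinite ((μ.withDensity fun x => (w x : ℝ≥0∞))) := by rw [← hν]; infer_instance
    refine ⟨map_swap_compProd_acceptReject (ha hr.measurable) ?_,
      map_swap_compProd_acceptReject (ha hr'.measurable) ?_, fun c hc0 hc F hF hF0 => ?_,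
      fun c hc0 hc F hF hF0 => ?_⟩
    · rw [h1, map_swap_inf_map_swap]
    · rw [h2, map_swap_inf_map_swap]
    all_goals
      rw [lintegral_compProd_acceptReject_of_diag (ha hr.measurable) hF hF0,
        lintegral_compProd_acceptReject_of_diag (ha hr'.measurable) hF hF0, h1, h2,
        ← smul_eq_mul, ← lintegral_smul_measure]
    · refine lintegral_mono' (inf_map_swap_le_smul hc0 ?_) le_rfl
      rw [← Measure.compProd_smul_left]
      refine compProd_mono_left ?_
      rw [hν]
      exact withDensity_le_smul (hc.mono fun x hx => ENNReal.coe_le_coe.2 hx)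
    · refine lintegral_mono' (inf_map_swap_le_smul (inv_ne_zero hc0) ?_) le_rfl
      rw [← Measure.compProd_smul_left]
      refine compProd_mono_left ?_
      rw [hν]
      exact le_inv_smul_withDensity hc0 (hc.mono fun x hx => ENNReal.coe_le_coe.2 hx)

/-! ### The function `w φ̄` in `L²(μ)`. -/

section Weighted

variable {μ ν : Measure X} [IsProbabilityMeasure μ] [IsProbabilityMeasure ν]
    {w : X → ℝ≥0} (hw : IsImportanceTriplet μ ν w)
include hw

theorem IsImportanceTriplet.integral_eq (g : X → ℝ) : ∫ x, g x ∂ν = ∫ x, (w x : ℝ) * g x ∂μ := by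
  conv_lhs => rw [hw.eq_withDensity, integral_withDensity_eq_integral_smul hw.measurable_weight]
  rfl

theorem IsImportanceTriplet.integral_weightedCentred {φ : X → ℝ} (hφ : MemLp φ 2 ν) :
    ∫ x, weightedCentred w ν φ x ∂μ = 0 := by
  unfold weightedCentred
  rw [← hw.integral_eq fun x => φ x - ∫ y, φ y ∂ν,
    integral_sub (hφ.integrable one_le_two) (integrable_const _)]
  simp

/-- Measurability of `φ` is only known modulo `ν`-null sets, which may have positive `μ`-measure;
the factor `w` repairs this by vanishing `μ`-a.e. on them. -/
theorem IsImportanceTriplet.aestronglyMeasurable_weightedCentred {φ : X → ℝ} (hφ : MemLp φ 2 ν) :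
    AEStronglyMeasurable (weightedCentred w ν φ) μ := by
  have h := hφ.1.sub (aestronglyMeasurable_const (b := ∫ y, φ y ∂ν))
  rw [hw.eq_withDensity, aestronglyMeasurable_withDensity_iff hw.measurable_weight] at h
  rw [← hw.eq_withDensity] at h
  exact h

theorem IsImportanceTriplet.memLp_weightedCentred {φ : X → ℝ} (hφ : MemLp φ 2 ν) {c : ℝ≥0}
    (hc : ∀ᵐ x ∂μ, w x ≤ c) : MemLp (weightedCentred w ν φ) 2 μ := by
  have hm := hw.aestronglyMeasurable_weightedCentred hφ
  rw [memLp_two_iff_integrable_sq hm]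
  have h1 := (hφ.sub (memLp_const (∫ y, φ y ∂ν))).integrable_sq
  have h2 : Integrable (fun x => (w x : ℝ) * (φ x - ∫ y, φ y ∂ν) ^ 2) μ := by
    rw [hw.eq_withDensity, integrable_withDensity_iff_integrable_smul hw.measurable_weight,
      ← hw.eq_withDensity] at h1
    exact h1
  -- `w² φ̄² ≤ c w φ̄²`, and `w φ̄²` is `μ`-integrable because `φ̄²` is `ν`-integrable.
  refine (h2.const_mul c).mono' (hm.pow 2) ?_
  filter_upwards [hc] with x hx
  have hx' : (w x : ℝ) ≤ c := hx
  rw [Real.norm_of_nonneg (by positivity), weightedCentred, mul_pow, sq (w x : ℝ), mul_assoc]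
  exact mul_le_mul_of_nonneg_right hx' (by positivity)

/-- The equality of functionals required by `asymVar_add_evariance_le`; the mean subtracted on the
left is zero. -/
theorem IsImportanceTriplet.integral_weightedCentred_mul {φ : X → ℝ} (hφ : MemLp φ 2 ν)
    (g : X → ℝ) :
    ∫ x, (weightedCentred w ν φ x - ∫ y, weightedCentred w ν φ y ∂μ) * g x ∂μ
      = ∫ x, (φ x - ∫ y, φ y ∂ν) * g x ∂ν := by
  rw [hw.integral_weightedCentred hφ, hw.integral_eq]
  simp only [sub_zero, weightedCentred, mul_assoc]

end Weighted

end Forms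

end PeskunIS

/-! ### The main theorem. -/

theorem mainTheorem4 {X : Type*} [MeasurableSpace X]
    (μ ν : Measure X) [IsProbabilityMeasure μ] [IsProbabilityMeasure ν] (w : X → ℝ≥0)
    (hw : PeskunIS.IsImportanceTriplet μ ν w)
    (K L : Kernel X X) [IsMarkovKernel K] [IsMarkovKernel L]
    (hKL : (Kernel.IsReversible K μ ∧ L = PeskunIS.daCorrection K w) ∨
      (∃ (q : Kernel X X) (_ : IsMarkovKernel q),
        PeskunIS.IsMetropolisHastings q μ K ∧ PeskunIS.IsMetropolisHastings q ν L)) :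
    (∀ cbar : ℝ≥0, (∀ᵐ x ∂μ, w x ≤ cbar) → ∀ φ : X → ℝ, MemLp φ 2 ν →
      MemLp (PeskunIS.weightedCentred w ν φ) 2 μ ∧
      PeskunIS.AsymVarExists K μ (PeskunIS.weightedCentred w ν φ) ∧
      PeskunIS.AsymVarExists L ν φ ∧
      PeskunIS.asymVar K μ (PeskunIS.weightedCentred w ν φ)
          + evariance (PeskunIS.weightedCentred w ν φ) μ
        ≤ (cbar : ℝ≥0∞) * (PeskunIS.asymVar L ν φ + evariance φ ν)) ∧
    (∀ cund : ℝ≥0, (∀ᵐ x ∂μ, cund ≤ w x) → ∀ φ : X → ℝ, MemLp φ 2 ν →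
      (MemLp (fun x => (w x : ℝ) * φ x) 2 μ ∨ MemLp (PeskunIS.weightedCentred w ν φ) 2 μ) →
      (MemLp (PeskunIS.weightedCentred w ν φ) 2 μ →
        PeskunIS.AsymVarExists K μ (PeskunIS.weightedCentred w ν φ)) ∧
      PeskunIS.AsymVarExists L ν φ ∧
      (cund : ℝ≥0∞) * (PeskunIS.asymVar L ν φ + evariance φ ν)
        ≤ PeskunIS.asymVar K μ (PeskunIS.weightedCentred w ν φ)
          + evariance (PeskunIS.weightedCentred w ν φ) μ) := by
  obtain ⟨hK, hL, hup, hlow⟩ := PeskunIS.reversible_and_form_le hw hKL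
  have hν := hw.eq_withDensity
  have hcentre : ∀ φ : X → ℝ, MemLp φ 2 ν → MemLp (PeskunIS.weightedCentred w ν φ) 2 μ →
      MemLp (fun x => PeskunIS.weightedCentred w ν φ x
        - ∫ y, PeskunIS.weightedCentred w ν φ y ∂μ) 2 μ := fun φ hφ h => by
    simpa only [hw.integral_weightedCentred hφ, sub_zero] using h
  have hφc : ∀ φ : X → ℝ, MemLp φ 2 ν → MemLp (fun x => φ x - ∫ y, φ y ∂ν) 2 ν :=
    fun φ hφ => hφ.sub (memLp_const _)
  refine ⟨fun c hc φ hφ => ?_, fun c hc φ hφ _ => ?_⟩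
  · have hm := hw.memLp_weightedCentred hφ hc
    have hle : ν ≤ (c : ℝ≥0∞) • μ := by
      conv_lhs => rw [hν]
      exact PeskunIS.withDensity_le_smul (hc.mono fun x hx => ENNReal.coe_le_coe.2 hx)
    -- A zero bound would force `ν = 0`, contradicting total mass one.
    have hc0 : c ≠ 0 := by
      rintro rfl
      have := hle Set.univ
      simp at this
    exact ⟨hm, (PeskunIS.exists_asymVar_limit hK (hcentre φ hφ hm)).1,
      (PeskunIS.exists_asymVar_limit hL (hφc φ hφ)).1,
      PeskunIS.asymVar_add_evariance_le hK hL hc0 hle (hup c hc0 hc) (hcentre φ hφ hm) (hφc φ hφ)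
        fun g _ => hw.integral_weightedCentred_mul hφ g⟩
  · refine ⟨fun hm => (PeskunIS.exists_asymVar_limit hK (hcentre φ hφ hm)).1,
      (PeskunIS.exists_asymVar_limit hL (hφc φ hφ)).1, ?_⟩
    rcases eq_or_ne c 0 with rfl | hc0
    · simp
    by_cases hm : MemLp (PeskunIS.weightedCentred w ν φ) 2 μ
    · have hle : μ ≤ ((c⁻¹ : ℝ≥0) : ℝ≥0∞) • ν := by
        rw [hν]
        exact PeskunIS.le_inv_smul_withDensity hc0 (hc.mono fun x hx => ENNReal.coe_le_coe.2 hx)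
      -- The same comparison with the chains exchanged and constant `c⁻¹`.
      have h := PeskunIS.asymVar_add_evariance_le hL hK (inv_ne_zero hc0) hle (hlow c hc0 hc)
        (hφc φ hφ) (hcentre φ hφ hm) fun g _ => (hw.integral_weightedCentred_mul hφ g).symm
      calc _ ≤ (c : ℝ≥0∞) * _ := mul_le_mul_right h _
        _ = _ := by
          rw [← mul_assoc, ← ENNReal.coe_mul, mul_inv_cancel₀ hc0, ENNReal.coe_one, one_mul]
    -- Outside `L²(μ)` the variance term alone is infinite.
    · rw [evariance_eq_top (hw.aestronglyMeasurable_weightedCentred hφ) hm, add_top]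
      exact le_top
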